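/- Fix $k\ge 1$ and $d$, and let $L_1,\dots,L_k$ be independent homogeneous Poisson processes on $\mathbb R^d$, with intensities $\lambda_1,\dots,\lambda_k>0$. In \emph{friendly frogs} on a set $L\subset\mathbb R^d$, two frogs occupy distinct points $x,y\in L$. A legal move consists of one frog jumping to another point of $L$ so that the distance between the two frogs strictly decreases and they do not share a point. Let $F(x,y)$ be the set of unordered pairs reachable from $\{x,y\}$ by one legal move. In \emph{$k$-pond friendly frogs} there are two frogs on distinct points in each of $L_1,\dots,L_k$. The two players, Alice and Bob, take turns, a move being a legal move in one of the sets $L_i$. A player who cannot move loses. The game is opened as follows: Alice places two frogs on distinct points in each of $L_1,\dots,L_{k-1}$ and one frog in $L_k$, then Bob places the final frog on another point of $L_k$, and Alice moves next. A strategy assigns a legal move (if one exists) to each position. It is winning for a player if it results in a win for that player whatever strategy the other player uses. A P-position is a position from which the player who is not next to move has a winning strategy. \textbf{Theorem.} With probability $1$, the following hold. (a) Bob wins, i.e. Bob has a winning strategy for the game including the opening. (b) There are maps $G_1,\dots,G_k$, where $G_i$ assigns a number in $\mathbb N=\{0,1,2,\dots\}$ to each unordered pair of distinct points of $L_i$,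 such that for every such pair $$G_i(x,y)=\min\bigl(\mathbb N\setminus\{G_i(u,v):\{u,v\}\in F_i(x,y)\}\bigr)\qquad(\ast)$$ ($F_i$ denoting $F$ for $L=L_i$), and such that for all $x\in L_i$ and $n\in\mathbb N$ there is a unique $y\in L_i\setminus\{x\}$ with $G_i(x,y)=n$. (c) For any maps $G_1,\dots,G_k$ satisfying $(\ast)$, a position with frogs at distinct $x_i,y_i\in L_i$, $i=1,\dots,k$, is a P-position if and only if $\bigoplus_{i=1}^k G_i(x_i,y_i)=0$, where $\oplus$ is bitwise XOR. -/

import Mathlib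

open MeasureTheory ProbabilityTheory
open scoped NNReal ENNReal

namespace FriendlyFrogs

/-! ### Two-player games of perfect information

A game is given by a type `S` of positions and a relation `move p q` saying that the player whose
turn it is at `p` may move to `q`. The players alternate; a player who cannot move loses. -/

section Games

variable {S : Type*}

/-- A strategy assigns a legal move, if one exists, to each position. -/
def IsStrategy (move : S → S → Prop) (σ : S → S) : Prop :=
  ∀ p, (∃ q, move p q) → move p (σ p)

/-- No move is possible from `p`. -/
def IsTerminal (move : S → S → Prop) (p : S) : Prop :=
  ∀ q, ¬ move p q

/-- The sequence of positions, starting from `p`, when the player who is next to move at `p` uses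
`σ` and the other player uses `τ`. (It is meaningful up to the first terminal position.) -/
def playSeq (σ τ : S → S) (p : S) : ℕ → S
  | 0 => p
  | n + 1 => if Even n then σ (playSeq σ τ p n) else τ (playSeq σ τ p n)

/-- The play ends, at a position where it is the turn of the player who was to move at `p`; that
is, the player next to move at `p` loses. -/
def PrevWinsPlay (move : S → S → Prop) (σ τ : S → S) (p : S) : Prop :=
  ∃ n, IsTerminal move (playSeq σ τ p n) ∧
    (∀ m < n, ¬ IsTerminal move (playSeq σ τ p m)) ∧ Even n

/-- `p` is a P-position: the player who is not next to move has a winning strategy, i.e. one that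
wins whatever strategy the next player uses. -/
def IsPPosition (move : S → S → Prop) (p : S) : Prop :=
  ∃ τ, IsStrategy move τ ∧ ∀ σ, IsStrategy move σ → PrevWinsPlay move σ τ p

end Games

/-! ### Friendly frogs -/

section Frogs

variable {E : Type*} [MetricSpace E]

/-- Two frogs on distinct points of `L`. -/
def IsFrogPair (L : Set E) (s : Sym2 E) : Prop :=
  ∃ x ∈ L, ∃ y ∈ L, x ≠ y ∧ s = s(x, y)

/-- A legal move in one pond: from the pair `s = {x, y}` of distinct points of `L`, the frog at `y`
jumps to a point `z ∈ L` distinct from `x` and strictly closer to `x` than `y` is. -/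
def FrogMove (L : Set E) (s t : Sym2 E) : Prop :=
  ∃ x ∈ L, ∃ y ∈ L, ∃ z ∈ L, x ≠ y ∧ x ≠ z ∧ s = s(x, y) ∧ t = s(x, z) ∧ dist x z < dist x y

/-- The mex rule: the label of each pair of distinct points of `L` is the least natural number
that is not the label of a pair to which one can legally move from it. -/
def IsGrundyLabelling (L : Set E) (G : Sym2 E → ℕ) : Prop :=
  ∀ s, IsFrogPair L s → IsLeast {n : ℕ | ∀ t, FrogMove L s t → G t ≠ n} (G s)

variable {ι : Type*}

/-- Positions of the multi-pond game with ponds indexed by `ι`, including the opening: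
`start` is the empty board; `opening s x` has the pair of frogs `s i` in every pond `i ≠ ℓ` and
a single frog at `x` in pond `ℓ`; `full s` has the pair of frogs `s i` in every pond `i`. -/
inductive Position (E : Type*) (ι : Type*) (ℓ : ι) where
  | start : Position E ι ℓ
  | opening (s : {i : ι // i ≠ ℓ} → Sym2 E) (x : E) : Position E ι ℓ
  | full (s : ι → Sym2 E) : Position E ι ℓ

/-- The legal moves of the multi-pond game, including the opening. -/
inductive PondMove (L : ι → Set E) (ℓ : ι) : Position E ι ℓ → Position E ι ℓ → Prop where
  /-- The first player places two frogs in every pond except `ℓ` and one frog in pond `ℓ`. -/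
  | place (s : {i : ι // i ≠ ℓ} → Sym2 E) (x : E)
      (hs : ∀ i, IsFrogPair (L i.1) (s i)) (hx : x ∈ L ℓ) :
      PondMove L ℓ Position.start (Position.opening s x)
  /-- The second player places the last frog, in pond `ℓ`. -/
  | complete (s : {i : ι // i ≠ ℓ} → Sym2 E) (x y : E) (t : ι → Sym2 E)
      (hy : y ∈ L ℓ) (hxy : y ≠ x) (ht : ∀ i, t i.1 = s i) (htℓ : t ℓ = s(x, y)) :
      PondMove L ℓ (Position.opening s x) (Position.full t)
  /-- One frog jumps in one pond. -/
  | jump (s t : ι → Sym2 E) (i : ι)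
      (hi : FrogMove (L i) (s i) (t i)) (hne : ∀ j, j ≠ i → t j = s j) :
      PondMove L ℓ (Position.full s) (Position.full t)

/-- Bob wins: he has a winning strategy from the empty board, where Alice is the next to move. -/
def BobWins (L : ι → Set E) (ℓ : ι) : Prop :=
  IsPPosition (PondMove L ℓ) Position.start

end Frogs

/-- The bitwise XOR of `g 0, …, g (k - 1)`. -/
def nimSum {k : ℕ} (g : Fin k → ℕ) : ℕ :=
  (List.ofFn g).foldr (fun a b => a ^^^ b) 0

/-! ### Poisson processes -/

section Poisson

variable {Ω : Type*} {d : ℕ}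

/-- The number of points of the random set `L` in `A`. -/
noncomputable def count (L : Ω → Set (EuclideanSpace ℝ (Fin d)))
    (A : Set (EuclideanSpace ℝ (Fin d))) (ω : Ω) : ℕ∞ :=
  (L ω ∩ A).encard

/-- The random set `L` is a homogeneous Poisson process of intensity `lam` on `ℝ^d`. -/
structure IsPoissonProcess [MeasurableSpace Ω] (P : Measure Ω) (lam : ℝ≥0)
    (L : Ω → Set (EuclideanSpace ℝ (Fin d))) : Prop where
  measurable_count : ∀ A, MeasurableSet A → Measurable (count L A)
  law_count : ∀ A, MeasurableSet A → volume A < ∞ →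
    P.map (count L A) =
      (poissonMeasure (lam * (volume A).toNNReal)).map (fun n : ℕ => (n : ℕ∞))
  indep_count : ∀ (n : ℕ) (A : Fin n → Set (EuclideanSpace ℝ (Fin d))),
    (∀ i, MeasurableSet (A i)) → (∀ i, volume (A i) < ∞) →
    Pairwise (fun i j => Disjoint (A i) (A j)) → iIndepFun (fun i => count L (A i)) P

/-- The σ-algebra on `Ω` generated by the random set `L`, i.e. by its counts in Borel sets. -/
@[reducible] noncomputable def sigmaOf (L : Ω → Set (EuclideanSpace ℝ (Fin d))) : MeasurableSpace Ω :=
  ⨆ A : {A : Set (EuclideanSpace ℝ (Fin d)) // MeasurableSet A},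
    MeasurableSpace.comap (count L A.1) inferInstance

end Poisson

end FriendlyFrogs

/-! Almost surely each pond is tame (`IsTame`): locally finite, free of isosceles triangles, and
without infinite plays. On a tame set the mex recursion defines the labels, and Sprague–Grundy
theory identifies the P-positions (`kernel_full_iff`). Two distinct pairs sharing a frog have
different lengths, so the shorter is an option of the longer and their labels differ; hence a point
has at most one partner with label `n`. Once such a partner always exists, Bob answers any opening
with the partner whose label makes the XOR vanish.

For existence, two points that both lack a partner with label `n` have a mutual label below `n`.
Labels at one point are distinct, so at most `n + 1` points of the pond lack such a partner
(`card_le_of_subset_unmatched`). By translation invariance every unit cube contains such a point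
with the same probability; summed over any number of cubes these probabilities stay below `n + 1`,
so they vanish (`ae_unmatched_eq_empty`).

The invariance is obtained by discretization. The occupied dyadic cubes of a given side form an
i.i.d. field; labels computed from it on the lattice are measurable and shift-equivariant, and they
agree eventually with the true labels (`eventually_latticeLabel_eq`).

Tameness rests on thin spherical shells having small volume. This makes isosceles triples of
occupied cubes improbable. In an infinite play the frog distances would decrease into an arbitrarily
thin window, where the graph joining occupied cubes at such distances is subcritical percolation
with finite clusters (`ae_finite_cluster`), leaving only finitely many pairs to visit. -/

namespace FriendlyFrogs

/-! ### Games without infinite plays -/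

section Games

variable {S : Type*} {move : S → S → Prop}

/-- The positions from which the player who has just moved wins, defined by recursion along a
well-founded move relation. -/
def Kernel (hwf : WellFounded fun q p => move p q) : S → Prop :=
  hwf.fix fun p ih => ∀ q, ∀ h : move p q, ¬ ih q h

lemma kernel_iff (hwf : WellFounded fun q p => move p q) (p : S) :
    Kernel hwf p ↔ ∀ q, move p q → ¬ Kernel hwf q := by
  unfold Kernel
  rw [hwf.fix_eq]

open Classical in
/-- A strategy which moves into `K` whenever it can. -/
noncomputable def moveInto (move : S → S → Prop) (K : S → Prop) (p : S) : S :=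
  if h : ∃ q, move p q ∧ K q then h.choose
  else if h : ∃ q, move p q then h.choose else p

lemma isStrategy_moveInto (K : S → Prop) : IsStrategy move (moveInto move K) := by
  intro p hp
  unfold moveInto
  split_ifs with h
  · exact h.choose_spec.1
  · exact hp.choose_spec

lemma moveInto_mem {K : S → Prop} {p : S} (h : ∃ q, move p q ∧ K q) :
    K (moveInto move K p) := by
  unfold moveInto
  rw [dif_pos h]
  exact h.choose_spec.2

lemma exists_move_of_not_isTerminal {p : S} (h : ¬ IsTerminal move p) : ∃ q, move p q := by
  unfold IsTerminal at h
  push Not at h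
  exact h

lemma playSeq_move {σ τ : S → S} (hσ : IsStrategy move σ) (hτ : IsStrategy move τ) (p : S) (n : ℕ)
    (h : ¬ IsTerminal move (playSeq σ τ p n)) :
    move (playSeq σ τ p n) (playSeq σ τ p (n + 1)) := by
  have h' := exists_move_of_not_isTerminal h
  simp only [playSeq]
  split_ifs
  · exact hσ _ h'
  · exact hτ _ h'

lemma exists_isTerminal_playSeq (hwf : WellFounded fun q p => move p q) {σ τ : S → S}
    (hσ : IsStrategy move σ) (hτ : IsStrategy move τ) (p : S) :
    ∃ n, IsTerminal move (playSeq σ τ p n) := by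
  by_contra! h
  exact (wellFounded_iff_isEmpty_descending_chain.1 hwf).false
    ⟨playSeq σ τ p, fun n => playSeq_move hσ hτ p n (h n)⟩

variable {K : S → Prop}

/-- Every move from `K` leaves `K`, and `moveInto` answers by returning to it; so membership
alternates as long as the play lasts. -/
lemma mem_playSeq_iff_even (hK : ∀ p, K p ↔ ∀ q, move p q → ¬ K q)
    {σ : S → S} (hσ : IsStrategy move σ) {p : S} (hp : K p) (n : ℕ)
    (hn : ∀ m < n, ¬ IsTerminal move (playSeq σ (moveInto move K) p m)) :
    K (playSeq σ (moveInto move K) p n) ↔ Even n := by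
  induction n with
  | zero => simpa [playSeq] using hp
  | succ n ih =>
    have ih := ih fun m hm => hn m (by omega)
    have hm := playSeq_move hσ (isStrategy_moveInto K) p n (hn n (by omega))
    rw [Nat.even_add_one]
    by_cases he : Even n
    · simpa [he] using (hK _).1 (ih.2 he) _ hm
    · have h1 : ¬ K (playSeq σ (moveInto move K) p n) := fun h => he (ih.1 h)
      rw [hK] at h1
      push Not at h1
      simpa [playSeq, he] using moveInto_mem h1

lemma mem_playSeq_iff_odd (hK : ∀ p, K p ↔ ∀ q, move p q → ¬ K q)
    {τ : S → S} (hτ : IsStrategy move τ) {p : S} (hp : ¬ K p) (n : ℕ)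
    (hn : ∀ m < n, ¬ IsTerminal move (playSeq (moveInto move K) τ p m)) :
    K (playSeq (moveInto move K) τ p n) ↔ ¬ Even n := by
  induction n with
  | zero => simpa [playSeq] using hp
  | succ n ih =>
    have ih := ih fun m hm => hn m (by omega)
    have hm := playSeq_move (isStrategy_moveInto K) hτ p n (hn n (by omega))
    rw [Nat.even_add_one, not_not]
    by_cases he : Even n
    · have h1 : ¬ K (playSeq (moveInto move K) τ p n) := fun h => ih.1 h he
      rw [hK] at h1
      push Not at h1
      simpa [playSeq, he] using moveInto_mem h1
    · simpa [he] using (hK _).1 (ih.2 he) _ hm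

/-- In a game without infinite plays the P-positions are the kernel of the move relation. -/
theorem isPPosition_iff (hwf : WellFounded fun q p => move p q)
    (hK : ∀ p, K p ↔ ∀ q, move p q → ¬ K q) (p : S) : IsPPosition move p ↔ K p := by
  classical
  constructor
  · rintro ⟨τ, hτ, h⟩
    by_contra hp
    obtain ⟨n, hn, hlt, he⟩ := h _ (isStrategy_moveInto K)
    -- A terminal position lies in `K` vacuously, hence is reached at an odd time only.
    exact (mem_playSeq_iff_odd hK hτ hp n hlt).1 ((hK _).2 fun q hq => absurd hq (hn q)) he
  · intro hp
    refine ⟨_, isStrategy_moveInto K, fun σ hσ => ?_⟩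
    have hex := exists_isTerminal_playSeq hwf hσ (isStrategy_moveInto K) p
    refine ⟨Nat.find hex, Nat.find_spec hex, fun m hm => Nat.find_min hex hm, ?_⟩
    exact (mem_playSeq_iff_even hK hσ hp _ fun m hm => Nat.find_min hex hm).1
      ((hK _).2 fun q hq => absurd hq (Nat.find_spec hex q))

end Games

/-! ### Nim sums -/

lemma nimSum_succ {k : ℕ} (g : Fin (k + 1) → ℕ) :
    nimSum g = g 0 ^^^ nimSum fun i => g i.succ := by
  simp [nimSum, List.ofFn_succ]

lemma nimSum_update {k : ℕ} (g : Fin k → ℕ) (i : Fin k) (n : ℕ) :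
    nimSum (Function.update g i n) = nimSum g ^^^ g i ^^^ n := by
  induction k with
  | zero => exact i.elim0
  | succ k ih =>
    rw [nimSum_succ, nimSum_succ]
    refine Fin.cases ?_ (fun j => ?_) i
    · have h : (fun j : Fin k => Function.update g 0 n j.succ) = fun j => g j.succ := by
        ext j
        simp
      rw [h, Function.update_self, Nat.xor_comm (g 0), Nat.xor_assoc _ (g 0) (g 0), Nat.xor_self,
        Nat.xor_zero, Nat.xor_comm]
    · have h : (fun l : Fin k => Function.update g j.succ n l.succ)
          = Function.update (fun l : Fin k => g l.succ) j n := by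
        ext l
        by_cases hl : l = j
        · subst hl
          simp
        · simp [hl, Function.update_of_ne]
      rw [h, ih, Function.update_of_ne (Fin.succ_ne_zero j).symm]
      simp only [Nat.xor_assoc]

lemma exists_testBit_of_testBit_nimSum {k : ℕ} (g : Fin k → ℕ) (b : ℕ)
    (h : (nimSum g).testBit b = true) : ∃ i, (g i).testBit b = true := by
  induction k with
  | zero => simp [nimSum] at h
  | succ k ih =>
    by_contra! hg
    have h0 : (nimSum fun i => g i.succ).testBit b ≠ true := fun h' => by
      obtain ⟨i, hi⟩ := ih _ h'
      exact hg _ hi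
    rw [nimSum_succ, Nat.testBit_xor] at h
    have := hg 0
    simp_all

/-- The leading bit of the nim sum is set in some `g i`; XORing with the nim sum clears that bit and
leaves the higher ones alone. -/
lemma exists_xor_nimSum_lt {k : ℕ} (g : Fin k → ℕ) (h : nimSum g ≠ 0) :
    ∃ i, nimSum g ^^^ g i < g i := by
  obtain ⟨b, hb, hmax⟩ := Nat.exists_most_significant_bit h
  obtain ⟨i, hi⟩ := exists_testBit_of_testBit_nimSum g b hb
  refine ⟨i, Nat.lt_of_testBit b ?_ hi fun j hj => ?_⟩
  · simp [Nat.testBit_xor, hb, hi]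
  · simp [Nat.testBit_xor, hmax j hj]

/-! ### Friendly frogs on a tame set -/

section Tame

variable {E : Type*} [MetricSpace E]

/-- A set is tame if it is locally finite, no three of its points form an isosceles triangle, and
friendly frogs on it always stops. -/
structure IsTame (L : Set E) : Prop where
  finite_inter : ∀ x r, (L ∩ Metric.closedBall x r).Finite
  eq_of_dist_eq : ∀ x ∈ L, ∀ y ∈ L, ∀ z ∈ L, dist x y = dist x z → y = z
  wf : WellFounded fun t s => FrogMove L s t

lemma FrogMove.isFrogPair {L : Set E} {s t : Sym2 E} (h : FrogMove L s t) : IsFrogPair L s := by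
  obtain ⟨x, hx, y, hy, z, hz, hxy, hxz, rfl, rfl, h⟩ := h
  exact ⟨x, hx, y, hy, hxy, rfl⟩

lemma FrogMove.isFrogPair_right {L : Set E} {s t : Sym2 E} (h : FrogMove L s t) :
    IsFrogPair L t := by
  obtain ⟨x, hx, y, hy, z, hz, hxy, hxz, rfl, rfl, h⟩ := h
  exact ⟨x, hx, z, hz, hxz, rfl⟩

lemma frogMove_mk_iff {L : Set E} {x y : E} (hx : x ∈ L) (hy : y ∈ L) (hxy : x ≠ y) (t : Sym2 E) :
    FrogMove L s(x, y) t ↔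
      (∃ z ∈ L, z ≠ x ∧ dist x z < dist x y ∧ t = s(x, z)) ∨
      (∃ z ∈ L, z ≠ y ∧ dist y z < dist y x ∧ t = s(y, z)) := by
  constructor
  · rintro ⟨a, ha, b, hb, z, hz, hab, haz, hs, rfl, h⟩
    rw [Sym2.eq_iff] at hs
    rcases hs with ⟨rfl, rfl⟩ | ⟨rfl, rfl⟩
    · exact Or.inl ⟨z, hz, haz.symm, h, rfl⟩
    · exact Or.inr ⟨z, hz, haz.symm, h, rfl⟩
  · rintro (⟨z, hz, hzx, h, rfl⟩ | ⟨z, hz, hzx, h, rfl⟩)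
    · exact ⟨x, hx, y, hy, z, hz, hxy, hzx.symm, rfl, rfl, h⟩
    · exact ⟨y, hy, x, hx, z, hz, hxy.symm, hzx.symm, Sym2.eq_swap, rfl, h⟩

lemma IsTame.finite_frogMove {L : Set E} (hL : IsTame L) (s : Sym2 E) :
    {t | FrogMove L s t}.Finite := by
  by_cases hs : IsFrogPair L s
  · obtain ⟨x, hx, y, hy, hxy, rfl⟩ := hs
    refine Set.Finite.subset (((hL.finite_inter x (dist x y)).image fun z => s(x, z)).union
      ((hL.finite_inter y (dist y x)).image fun z => s(y, z))) fun t ht => ?_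
    rcases (frogMove_mk_iff hx hy hxy t).1 ht with ⟨z, hz, -, h, rfl⟩ | ⟨z, hz, -, h, rfl⟩
    · exact Or.inl ⟨z, ⟨hz, by rw [Metric.mem_closedBall']; exact h.le⟩, rfl⟩
    · exact Or.inr ⟨z, ⟨hz, by rw [Metric.mem_closedBall']; exact h.le⟩, rfl⟩
  · convert Set.finite_empty
    ext t
    simpa using fun h : FrogMove L s t => hs h.isFrogPair

lemma IsTame.exists_isGrundyLabelling {L : Set E} (hL : IsTame L) :
    ∃ G, IsGrundyLabelling L G := by
  let G : Sym2 E → ℕ := hL.wf.fix fun s ih => sInf {n | ∀ t, ∀ h : FrogMove L s t, ih t h ≠ n}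
  have hG : ∀ s, G s = sInf {n | ∀ t, FrogMove L s t → G t ≠ n} := fun s => hL.wf.fix_eq _ s
  refine ⟨G, fun s _ => ?_⟩
  -- Finitely many options leave some number free, so `sInf` is a genuine minimum and not its
  -- default value.
  have hne : {n | ∀ t, FrogMove L s t → G t ≠ n}.Nonempty := by
    obtain ⟨n, hn⟩ := ((hL.finite_frogMove s).image G).exists_notMem
    exact ⟨n, fun t ht h => hn ⟨t, ht, h⟩⟩
  rw [hG s]
  exact ⟨Nat.sInf_mem hne, fun n hn => Nat.sInf_le hn⟩

variable {L : Set E} {G : Sym2 E → ℕ}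

lemma IsGrundyLabelling.ne_of_frogMove (hG : IsGrundyLabelling L G) {s t : Sym2 E}
    (h : FrogMove L s t) : G t ≠ G s :=
  (hG s h.isFrogPair).1 t h

lemma IsGrundyLabelling.exists_frogMove (hG : IsGrundyLabelling L G) {s : Sym2 E}
    (hs : IsFrogPair L s) {n : ℕ} (hn : n < G s) : ∃ t, FrogMove L s t ∧ G t = n := by
  by_contra! h
  exact absurd ((hG s hs).2 h) (not_le.2 hn)

lemma IsGrundyLabelling.eq_of_label_eq (hL : IsTame L) (hG : IsGrundyLabelling L G)
    {x y z : E} (hx : x ∈ L) (hy : y ∈ L) (hz : z ∈ L) (hyx : y ≠ x) (hzx : z ≠ x)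
    (h : G s(x, y) = G s(x, z)) : y = z := by
  rcases lt_trichotomy (dist x y) (dist x z) with hlt | heq | hlt
  · exact absurd h (hG.ne_of_frogMove ((frogMove_mk_iff hx hz hzx.symm _).2
      (Or.inl ⟨y, hy, hyx, hlt, rfl⟩)))
  · exact hL.eq_of_dist_eq x hx y hy z hz heq
  · exact absurd h.symm (hG.ne_of_frogMove ((frogMove_mk_iff hx hy hyx.symm _).2
      (Or.inl ⟨z, hz, hzx, hlt, rfl⟩)))

/-- The points of `L` that have no partner with label `n`. -/
def unmatched (L : Set E) (G : Sym2 E → ℕ) (n : ℕ) : Set E :=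
  {x | x ∈ L ∧ ∀ y ∈ L, y ≠ x → G s(x, y) ≠ n}

/-- A label above `n` would have an option labelled `n`; that option keeps one of the two frogs in
place and so gives `x` or `y` the forbidden partner. -/
lemma label_lt_of_unmatched (hG : IsGrundyLabelling L G) {n : ℕ} {x y : E}
    (hx : x ∈ unmatched L G n) (hy : y ∈ unmatched L G n) (hyx : y ≠ x) : G s(x, y) < n := by
  refine lt_of_le_of_ne (not_lt.1 fun hlt => ?_) (hx.2 y hy.1 hyx)
  obtain ⟨t, ht, htn⟩ := hG.exists_frogMove ⟨x, hx.1, y, hy.1, hyx.symm, rfl⟩ hlt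
  rcases (frogMove_mk_iff hx.1 hy.1 hyx.symm t).1 ht with ⟨z, hz, hzx, -, rfl⟩ | ⟨z, hz, hzx, -, rfl⟩
  · exact hx.2 z hz hzx htn
  · exact hy.2 z hz hzx htn

/-- Fix one point of `T`: its labels with the others are distinct and lie in `{0, …, n - 1}`. -/
lemma card_le_of_subset_unmatched (hL : IsTame L) (hG : IsGrundyLabelling L G) (n : ℕ)
    (T : Finset E) (hT : ∀ x ∈ T, x ∈ unmatched L G n) : T.card ≤ n + 1 := by
  classical
  rcases T.eq_empty_or_nonempty with rfl | ⟨x, hx⟩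
  · simp
  have h : (T.erase x).card ≤ (Finset.range n).card := by
    refine Finset.card_le_card_of_injOn (fun y => G s(x, y)) (fun y hy => ?_) fun y hy z hz h => ?_
    · have hy' := Finset.mem_erase.1 hy
      simpa using label_lt_of_unmatched hG (hT x hx) (hT y hy'.2) hy'.1
    · have hy' := Finset.mem_erase.1 hy
      have hz' := Finset.mem_erase.1 hz
      exact hG.eq_of_label_eq hL (hT x hx).1 (hT y hy'.2).1 (hT z hz'.2).1 hy'.1 hz'.1 h
  rw [Finset.card_erase_of_mem hx, Finset.card_range] at h
  omega

/-! ### The multi-pond game -/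

variable {k : ℕ} {L : Fin k → Set E} {ℓ : Fin k}

lemma wellFounded_pondMove (hL : ∀ i, IsTame (L i)) (ℓ : Fin k) :
    WellFounded fun q p => PondMove L ℓ p q := by
  have hfull : ∀ s, Acc (fun q p => PondMove L ℓ p q) (Position.full s) := by
    -- A jump lowers one coordinate and fixes the others, hence decreases in the lexicographic order
    -- on the ponds.
    have hwf := Pi.Lex.wellFounded (r := fun i j : Fin k => i < j)
      (s := fun {i} t s => FrogMove (L i) s t) fun i => (hL i).wf
    intro s
    induction s using hwf.induction with
    | _ s ih =>
      refine ⟨_, fun q hq => ?_⟩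
      cases hq with
      | jump s t i hi hne => exact ih t ⟨i, fun j hj => hne j hj.ne, hi⟩
  have hopen : ∀ s x, Acc (fun q p => PondMove L ℓ p q) (Position.opening s x) := fun s x =>
    ⟨_, fun q hq => by cases hq with | complete => exact hfull _⟩
  refine ⟨fun p => ?_⟩
  cases p with
  | start => exact ⟨_, fun q hq => by cases hq with | place => exact hopen _ _⟩
  | opening s x => exact hopen s x
  | full s => exact hfull s

variable {G : Fin k → Sym2 E → ℕ}

/-- A jump changes exactly one label, so it destroys a zero sum; from a nonzero sum,
`exists_xor_nimSum_lt` names a label that the mex rule allows to be lowered to the value restoring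
zero. -/
lemma kernel_full_iff (hwf : WellFounded fun q p => PondMove L ℓ p q)
    (hG : ∀ i, IsGrundyLabelling (L i) (G i)) (s : Fin k → Sym2 E)
    (hs : ∀ i, IsFrogPair (L i) (s i)) :
    Kernel hwf (Position.full s) ↔ nimSum (fun i => G i (s i)) = 0 := by
  have key : ∀ p, ∀ s, p = Position.full s → (∀ i, IsFrogPair (L i) (s i)) →
      (Kernel hwf p ↔ nimSum (fun i => G i (s i)) = 0) := by
    intro p
    induction p using hwf.induction with
    | _ p ih =>
      rintro s rfl hs
      have hupd : ∀ (i : Fin k) (t : Sym2 E), nimSum (fun j => G j (Function.update s i t j))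
          = nimSum (fun j => G j (s j)) ^^^ G i (s i) ^^^ G i t := by
        intro i t
        rw [← nimSum_update]
        congr 1
        ext j
        by_cases hj : j = i
        · subst hj
          simp
        · simp [hj]
      have hvalid : ∀ (i : Fin k) (t : Sym2 E), IsFrogPair (L i) t →
          ∀ j, IsFrogPair (L j) (Function.update s i t j) := by
        intro i t ht j
        by_cases hj : j = i
        · subst hj
          simpa using ht
        · simpa [hj] using hs j
      have hjump : ∀ (i : Fin k) (t : Sym2 E), FrogMove (L i) (s i) t →
          PondMove L ℓ (Position.full s) (Position.full (Function.update s i t)) :=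
        fun i t h => PondMove.jump s _ i (by simpa using h) fun j hj => by simp [hj]
      rw [kernel_iff]
      constructor
      · intro h
        by_contra h0
        obtain ⟨i, hi⟩ := exists_xor_nimSum_lt _ h0
        obtain ⟨t, ht, htn⟩ := (hG i).exists_frogMove (hs i) hi
        refine h _ (hjump i t ht) ((ih _ (hjump i t ht) _ rfl
          (hvalid i t ht.isFrogPair_right)).2 ?_)
        rw [hupd, htn, Nat.xor_self]
      · intro h0 q hq
        cases hq with
        | jump s t i hi hne =>
          have ht : t = Function.update s i (t i) := by
            ext j
            by_cases hj : j = i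
            · subst hj
              simp
            · simp [hj, hne j hj]
          rw [ih _ (PondMove.jump s t i hi hne) t rfl
            (by rw [ht]; exact hvalid i (t i) hi.isFrogPair_right), ht, hupd, h0, Nat.zero_xor,
            Nat.xor_eq_zero_iff]
          exact ((hG i).ne_of_frogMove hi).symm
  exact key _ s rfl hs

theorem isPPosition_full_iff (hL : ∀ i, IsTame (L i))
    (hG : ∀ i, IsGrundyLabelling (L i) (G i)) (s : Fin k → Sym2 E)
    (hs : ∀ i, IsFrogPair (L i) (s i)) :
    IsPPosition (PondMove L ℓ) (Position.full s) ↔ nimSum (fun i => G i (s i)) = 0 := by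
  have hwf := wellFounded_pondMove hL ℓ
  rw [isPPosition_iff hwf (kernel_iff hwf), kernel_full_iff hwf hG s hs]

theorem bobWins_of_forall_exists (hL : ∀ i, IsTame (L i))
    (hG : ∀ i, IsGrundyLabelling (L i) (G i))
    (hex : ∀ x ∈ L ℓ, ∀ n, ∃ y ∈ L ℓ, y ≠ x ∧ G ℓ s(x, y) = n) : BobWins L ℓ := by
  have hwf := wellFounded_pondMove hL ℓ
  rw [BobWins, isPPosition_iff hwf (kernel_iff hwf), kernel_iff]
  intro q hq
  cases hq with
  | place s x hs hx =>
    rw [kernel_iff]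
    push Not
    -- With `0` in slot `ℓ`, `nimSum g` is the XOR of the labels Alice has fixed, which is the label
    -- Bob must create.
    let g : Fin k → ℕ := fun i => if h : i = ℓ then 0 else G i (s ⟨i, h⟩)
    obtain ⟨y, hy, hyx, hyn⟩ := hex x hx (nimSum g)
    let t : Fin k → Sym2 E := fun i => if h : i = ℓ then s(x, y) else s ⟨i, h⟩
    have ht : ∀ i : {i // i ≠ ℓ}, t i.1 = s i := fun i => dif_neg i.2
    have htℓ : t ℓ = s(x, y) := dif_pos rfl
    refine ⟨_, PondMove.complete s x y t hy hyx ht htℓ, ?_⟩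
    rw [kernel_full_iff hwf hG]
    · have h : (fun i => G i (t i)) = Function.update g ℓ (nimSum g) := by
        ext i
        by_cases hi : i = ℓ
        · subst hi
          rw [htℓ, Function.update_self, hyn]
        · simp [t, g, hi]
      rw [h, nimSum_update]
      simp [g]
    · intro i
      by_cases hi : i = ℓ
      · subst hi
        exact ⟨x, hx, y, hy, hyx.symm, htℓ⟩
      · rw [ht ⟨i, hi⟩]
        exact hs ⟨i, hi⟩

end Tame

/-! ### Dyadic cubes -/

section Cubes

variable {d : ℕ}

/-- The index of the dyadic cube of side `2⁻ᵐ` that contains `x`. -/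
noncomputable def cell (m : ℕ) (x : EuclideanSpace ℝ (Fin d)) : Fin d → ℤ :=
  fun i => ⌊(2 : ℝ) ^ m * x i⌋

/-- The dyadic cube of side `2⁻ᵐ` with index `u`. -/
def cube (m : ℕ) (u : Fin d → ℤ) : Set (EuclideanSpace ℝ (Fin d)) :=
  {x | cell m x = u}

/-- The lower corner of the dyadic cube of side `2⁻ᵐ` with index `u`. -/
noncomputable def corner (m : ℕ) (u : Fin d → ℤ) : EuclideanSpace ℝ (Fin d) :=
  WithLp.toLp 2 fun i => (u i : ℝ) / 2 ^ m

/-- An upper bound for the diameter of the dyadic cubes of side `2⁻ᵐ`. -/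
noncomputable def mesh (d m : ℕ) : ℝ := d / 2 ^ m

/-- The volume of the dyadic cubes of side `2⁻ᵐ`. -/
noncomputable def cubeVolume (d m : ℕ) : ℝ≥0 := ((2 : ℝ≥0) ^ m)⁻¹ ^ d

lemma mesh_nonneg (d m : ℕ) : 0 ≤ mesh d m := by
  unfold mesh
  positivity

lemma tendsto_mesh (d : ℕ) : Filter.Tendsto (mesh d) Filter.atTop (nhds 0) := by
  unfold mesh
  exact Filter.Tendsto.div_atTop tendsto_const_nhds (tendsto_pow_atTop_atTop_of_one_lt one_lt_two)

lemma cubeVolume_pos (d m : ℕ) : 0 < cubeVolume d m := by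
  unfold cubeVolume
  positivity

lemma measurable_cell (m : ℕ) : Measurable (cell (d := d) m) := by
  unfold cell
  fun_prop

lemma measurableSet_cube (m : ℕ) (u : Fin d → ℤ) : MeasurableSet (cube m u) :=
  measurable_cell m (measurableSet_singleton u)

lemma disjoint_cube (m : ℕ) {u v : Fin d → ℤ} (h : u ≠ v) : Disjoint (cube m u) (cube m v) :=
  Set.disjoint_left.2 fun _ hx hy => h (hx.symm.trans hy)

lemma cell_corner (m : ℕ) (u : Fin d → ℤ) : cell m (corner m u) = u := by
  ext i
  have h : (2 : ℝ) ^ m * ((u i : ℝ) / 2 ^ m) = u i := by field_simp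
  simp [cell, corner, h]

lemma volume_cube (m : ℕ) (u : Fin d → ℤ) : volume (cube m u) = cubeVolume d m := by
  have h : cube m u = WithLp.ofLp ⁻¹'
      Set.univ.pi fun i => Set.Ico ((u i : ℝ) / 2 ^ m) (((u i : ℝ) + 1) / 2 ^ m) := by
    ext x
    have h2 : (0 : ℝ) < 2 ^ m := by positivity
    simp only [cube, cell, Set.mem_ofPred_eq, funext_iff, Int.floor_eq_iff, Set.mem_preimage,
      Set.mem_univ_pi, Set.mem_Ico, div_le_iff₀ h2, lt_div_iff₀ h2, mul_comm _ ((2 : ℝ) ^ m)]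
  rw [h, (PiLp.volume_preserving_ofLp (Fin d)).measure_preimage
      (MeasurableSet.univ_pi fun _ => measurableSet_Ico).nullMeasurableSet,
    Real.volume_pi_Ico]
  have h1 : ∀ i : Fin d, ((u i : ℝ) + 1) / 2 ^ m - (u i : ℝ) / 2 ^ m = ((2 : ℝ≥0) ^ m)⁻¹ := by
    intro i
    push_cast
    ring
  simp only [h1, ENNReal.ofReal_coe_nnreal, Finset.prod_const, Finset.card_univ, Fintype.card_fin,
    cubeVolume]
  rw [ENNReal.coe_pow]

lemma dist_le_mul_of_forall_abs_le {x y : EuclideanSpace ℝ (Fin d)} {b : ℝ} (hb : 0 ≤ b)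
    (h : ∀ i, |x i - y i| ≤ b) : dist x y ≤ d * b := by
  rw [EuclideanSpace.dist_eq, Real.sqrt_le_left (by positivity)]
  calc ∑ i, dist (x i) (y i) ^ 2 ≤ ∑ _i : Fin d, b ^ 2 := by
        refine Finset.sum_le_sum fun i _ => ?_
        rw [Real.dist_eq]
        exact pow_le_pow_left₀ (abs_nonneg _) (h i) 2
    _ = d * b ^ 2 := by simp
    -- The sharp factor would be `√d`; only the convergence of `mesh` to `0` matters.
    _ ≤ d ^ 2 * b ^ 2 := by
        refine mul_le_mul_of_nonneg_right ?_ (by positivity)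
        exact_mod_cast Nat.le_self_pow two_ne_zero d
    _ = (d * b) ^ 2 := by ring

lemma dist_le_mesh {m : ℕ} {x y : EuclideanSpace ℝ (Fin d)} (h : cell m x = cell m y) :
    dist x y ≤ mesh d m := by
  have h2 : (0 : ℝ) < 2 ^ m := by positivity
  have := dist_le_mul_of_forall_abs_le (x := x) (y := y) (b := 1 / 2 ^ m) (by positivity) fun i => by
    have hi := Int.abs_sub_lt_one_of_floor_eq_floor (congrFun h i)
    rw [← mul_sub, abs_mul, abs_of_pos h2] at hi
    rw [le_div_iff₀ h2, mul_comm]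
    exact hi.le
  rwa [mul_one_div] at this

lemma dist_corner_cell_le (m : ℕ) (x : EuclideanSpace ℝ (Fin d)) :
    dist (corner m (cell m x)) x ≤ mesh d m :=
  dist_le_mesh (cell_corner m _)

lemma abs_dist_corner_sub_dist_le (m : ℕ) (x y : EuclideanSpace ℝ (Fin d)) :
    |dist (corner m (cell m x)) (corner m (cell m y)) - dist x y| ≤ 2 * mesh d m := by
  have hx := dist_corner_cell_le m x
  have hy := dist_corner_cell_le m y
  have h := dist_dist_dist_le (corner m (cell m x)) (corner m (cell m y)) x y
  rw [Real.dist_eq] at h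
  linarith

lemma finite_image_cell (m : ℕ) (x : EuclideanSpace ℝ (Fin d)) (r : ℝ) :
    (cell m '' Metric.closedBall x r).Finite := by
  refine (Set.finite_Icc (fun i => ⌊(2 : ℝ) ^ m * (x i - r)⌋)
    (fun i => ⌊(2 : ℝ) ^ m * (x i + r)⌋)).subset ?_
  rintro _ ⟨y, hy, rfl⟩
  have h : ∀ i, |y i - x i| ≤ r := fun i => by
    rw [Metric.mem_closedBall, dist_eq_norm] at hy
    exact (PiLp.norm_apply_le (y - x) i).trans hy
  constructor <;> intro i <;> refine Int.floor_le_floor (mul_le_mul_of_nonneg_left ?_ (by positivity))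
  · linarith [(abs_le.1 (h i)).1]
  · linarith [(abs_le.1 (h i)).2]

lemma card_mul_cubeVolume_le (m : ℕ) {A : Set (EuclideanSpace ℝ (Fin d))}
    (s : Finset (Fin d → ℤ)) (hs : ∀ u ∈ s, cube m u ⊆ A) :
    (s.card : ℝ≥0∞) * cubeVolume d m ≤ volume A := by
  calc (s.card : ℝ≥0∞) * cubeVolume d m = ∑ u ∈ s, volume (cube m u) := by
        simp [volume_cube]
    _ = volume (⋃ u ∈ s, cube m u) :=
        (measure_biUnion_finset (fun u _ v _ h => disjoint_cube m h)
          fun u _ => measurableSet_cube m u).symm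
    _ ≤ volume A := measure_mono (Set.iUnion₂_subset hs)

/-- Thin spherical shells of bounded radius have small volume. -/
lemma exists_volume_shell_le (hd : 0 < d) (R : ℝ) {η : ℝ≥0} (hη : 0 < η) :
    ∃ ε > 0, ∀ (x : EuclideanSpace ℝ (Fin d)), ∀ a ∈ Set.Icc 0 R,
      volume (Metric.closedBall x (a + ε) \ Metric.ball x (a - ε)) ≤ η := by
  have : Nonempty (Fin d) := ⟨⟨0, hd⟩⟩
  let c : ℝ := (volume (Metric.ball (0 : EuclideanSpace ℝ (Fin d)) 1)).toReal
  -- Ball volume up to the constant-free extension by `0` to negative radii, since the inner radius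
  -- `a - ε` may be negative; continuity of this `f` then makes `ε` uniform in `a`.
  let f : ℝ → ℝ := fun r => max r 0 ^ d * c
  have hc : volume (Metric.ball (0 : EuclideanSpace ℝ (Fin d)) 1) = ENNReal.ofReal c :=
    (ENNReal.ofReal_toReal measure_ball_lt_top.ne).symm
  have hf : UniformContinuousOn f (Set.Icc (-1) (R + 1)) :=
    isCompact_Icc.uniformContinuousOn_of_continuous (by fun_prop)
  have hcb : ∀ (x : EuclideanSpace ℝ (Fin d)) (r : ℝ), 0 ≤ r →
      volume (Metric.closedBall x r) = ENNReal.ofReal (f r) := by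
    intro x r hr
    rw [Measure.addHaar_closedBall _ _ hr, hc, ← ENNReal.ofReal_mul (by positivity),
      finrank_euclideanSpace_fin]
    simp [f, max_eq_left hr]
  have hb : ∀ (x : EuclideanSpace ℝ (Fin d)) (r : ℝ),
      volume (Metric.ball x r) = ENNReal.ofReal (f r) := by
    intro x r
    rcases le_total 0 r with hr | hr
    · rw [Measure.addHaar_ball _ _ hr, hc, ← ENNReal.ofReal_mul (by positivity),
        finrank_euclideanSpace_fin]
      simp [f, max_eq_left hr]
    · simp [Metric.ball_eq_empty.2 hr, f, max_eq_right hr, hd.ne']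
  obtain ⟨δ, hδ, h⟩ := Metric.uniformContinuousOn_iff.1 hf η hη
  -- The two radii differ by `2 * ε < δ`, and `ε ≤ 1` keeps them in `[-1, R + 1]`.
  refine ⟨min (δ / 3) 1, by positivity, fun x a ha => ?_⟩
  set ε := min (δ / 3) 1 with hε
  have hε0 : 0 < ε := by positivity
  have hε1 : ε ≤ 1 := min_le_right _ _
  have hεδ : ε ≤ δ / 3 := min_le_left _ _
  rw [measure_sdiff ((Metric.ball_subset_ball (by linarith)).trans Metric.ball_subset_closedBall)
    measurableSet_ball.nullMeasurableSet measure_ball_lt_top.ne, hcb _ _ (by linarith [ha.1]), hb,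
    ← ENNReal.ofReal_sub _ (by positivity)]
  have h' := h (a + ε) ⟨by linarith [ha.1], by linarith [ha.2]⟩ (a - ε)
    ⟨by linarith [ha.1], by linarith [ha.2]⟩ (by rw [Real.dist_eq, abs_lt]; constructor <;> linarith)
  rw [Real.dist_eq] at h'
  rw [← ENNReal.ofReal_coe_nnreal]
  exact ENNReal.ofReal_le_ofReal ((le_abs_self _).trans h'.le)

/-- The indices of the dyadic cubes of side `2⁻ᵐ` that meet the set `L`. -/
def occ (m : ℕ) (L : Set (EuclideanSpace ℝ (Fin d))) : Set (Fin d → ℤ) := cell m '' L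

lemma mem_occ_iff {m : ℕ} {L : Set (EuclideanSpace ℝ (Fin d))} {u : Fin d → ℤ} :
    u ∈ occ m L ↔ (L ∩ cube m u).Nonempty := by
  constructor
  · rintro ⟨x, hx, rfl⟩
    exact ⟨x, hx, rfl⟩
  · rintro ⟨x, hx, rfl⟩
    exact ⟨x, hx, rfl⟩

end Cubes

/-! ### Poisson processes on dyadic cubes -/

section PoissonCubes

variable {Ω : Type*} [MeasurableSpace Ω] {P : Measure Ω} {d : ℕ} {lam : ℝ≥0}
  {L : Ω → Set (EuclideanSpace ℝ (Fin d))}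

/-- The probability that a dyadic cube of side `2⁻ᵐ` is occupied. -/
noncomputable def occProb (d : ℕ) (lam : ℝ≥0) (m : ℕ) : ℝ≥0∞ :=
  poissonMeasure (lam * cubeVolume d m) {0}ᶜ

lemma occProb_le (d : ℕ) (lam : ℝ≥0) (m : ℕ) : occProb d lam m ≤ lam * cubeVolume d m := by
  rw [occProb, prob_compl_eq_one_sub (measurableSet_singleton 0), poissonMeasure_singleton,
    ← ENNReal.ofReal_one, ← ENNReal.ofReal_sub _ (by positivity), ← ENNReal.coe_mul,
    ← ENNReal.ofReal_coe_nnreal]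
  refine ENNReal.ofReal_le_ofReal ?_
  have := Real.add_one_le_exp (-((lam * cubeVolume d m : ℝ≥0) : ℝ))
  simp only [pow_zero, mul_one, Nat.factorial_zero, Nat.cast_one, div_one]
  linarith

lemma count_ne_zero_iff {Ω : Type*} {L : Ω → Set (EuclideanSpace ℝ (Fin d))} {m : ℕ}
    {u : Fin d → ℤ} {ω : Ω} :
    count L (cube m u) ω ≠ 0 ↔ u ∈ occ m (L ω) := by
  rw [count, Set.encard_ne_zero, mem_occ_iff]

lemma IsPoissonProcess.measurableSet_mem_occ (hL : IsPoissonProcess P lam L) (m : ℕ)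
    (u : Fin d → ℤ) : MeasurableSet {ω | u ∈ occ m (L ω)} := by
  simp only [← count_ne_zero_iff]
  exact hL.measurable_count _ (measurableSet_cube m u) (measurableSet_singleton 0).compl

lemma IsPoissonProcess.measurable_occ (hL : IsPoissonProcess P lam L) (m : ℕ) :
    Measurable fun ω => occ m (L ω) :=
  measurable_set_iff.2 fun u => measurableSet_setOfPred.1 (hL.measurableSet_mem_occ m u)

lemma IsPoissonProcess.measure_mem_occ (hL : IsPoissonProcess P lam L) (m : ℕ) (u : Fin d → ℤ) :
    P {ω | u ∈ occ m (L ω)} = occProb d lam m := by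
  have hv := volume_cube m u
  have h := congrArg (fun μ => μ {0}ᶜ) (hL.law_count (cube m u) (measurableSet_cube m u)
    (by rw [hv]; exact ENNReal.coe_lt_top))
  rw [Measure.map_apply (hL.measurable_count _ (measurableSet_cube m u))
    (measurableSet_singleton 0).compl, Measure.map_apply .of_discrete
    (measurableSet_singleton 0).compl, hv, ENNReal.toNNReal_coe] at h
  simp only [← count_ne_zero_iff]
  refine h.trans ?_
  rw [occProb]
  congr 1
  ext n
  simp

lemma IsPoissonProcess.iIndepFun_occ (hL : IsPoissonProcess P lam L) (m : ℕ) :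
    iIndepFun (fun (u : Fin d → ℤ) ω => u ∈ occ m (L ω)) P := by
  have h : iIndepFun (fun (u : Fin d → ℤ) ω => count L (cube m u) ω) P := by
    rw [iIndepFun_iff_finset]
    intro s
    have h1 := hL.indep_count _ (fun i => cube m (s.equivFin.symm i).1)
      (fun i => measurableSet_cube m _)
      (fun i => by rw [volume_cube]; exact ENNReal.coe_lt_top)
      (fun i j hij => disjoint_cube m fun h => hij (s.equivFin.symm.injective (Subtype.ext h)))
    have h2 := h1.precomp s.equivFin.injective
    convert! h2 using 2 with u
    simp [Finset.restrict]
  have h3 := h.comp (fun _ n => n ≠ 0) fun _ =>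
    measurableSet_setOfPred.1 (measurableSet_singleton (0 : ℕ∞)).compl
  have h4 : (fun (u : Fin d → ℤ) ω => u ∈ occ m (L ω))
      = fun u => (fun n : ℕ∞ => n ≠ 0) ∘ fun ω => count L (cube m u) ω := by
    ext u ω
    exact count_ne_zero_iff.symm
  rwa [h4]

lemma IsPoissonProcess.measure_subset_occ (hL : IsPoissonProcess P lam L) (m : ℕ)
    (s : Finset (Fin d → ℤ)) :
    P {ω | ∀ u ∈ s, u ∈ occ m (L ω)} = occProb d lam m ^ s.card := by
  have h := (hL.iIndepFun_occ m).measure_inter_preimage_eq_mul s (sets := fun _ => {True})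
    fun _ _ => .of_discrete
  have h1 : ∀ u : Fin d → ℤ, (fun ω => u ∈ occ m (L ω)) ⁻¹' {True} = {ω | u ∈ occ m (L ω)} := by
    intro u
    ext ω
    simp
  simp only [h1, hL.measure_mem_occ, Finset.prod_const] at h
  rw [← h]
  congr 1
  ext ω
  simp

lemma IsPoissonProcess.ae_finite_inter (hL : IsPoissonProcess P lam L) :
    ∀ᵐ ω ∂P, ∀ x r, (L ω ∩ Metric.closedBall x r).Finite := by
  have h : ∀ᵐ ω ∂P, ∀ u : Fin d → ℤ, count L (cube 0 u) ω ≠ ⊤ := by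
    rw [ae_all_iff]
    intro u
    have hm := hL.measurable_count _ (measurableSet_cube 0 u)
    have h := congrArg (fun μ => μ {⊤}) (hL.law_count (cube 0 u) (measurableSet_cube 0 u)
      (by rw [volume_cube]; exact ENNReal.coe_lt_top))
    rw [Measure.map_apply hm (measurableSet_singleton _), Measure.map_apply .of_discrete
      (measurableSet_singleton _)] at h
    -- The law of the count is carried by `ℕ`, so it gives no mass to `⊤`.
    have h0 : (fun n : ℕ => (n : ℕ∞)) ⁻¹' {⊤} = ∅ := by
      ext n
      simp
    rw [h0, measure_empty] at h
    rw [ae_iff]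
    simpa only [not_not] using! h
  filter_upwards [h] with ω hω x r
  have hsub : L ω ∩ Metric.closedBall x r ⊆
      ⋃ u ∈ cell 0 '' Metric.closedBall x r, L ω ∩ cube 0 u :=
    fun y hy => Set.mem_biUnion (Set.mem_image_of_mem _ hy.2) ⟨hy.1, rfl⟩
  refine Set.Finite.subset ((finite_image_cell 0 x r).biUnion fun u _ => ?_) hsub
  exact Set.encard_ne_top_iff.1 (hω u)

/-- On the one-point space `ℝ⁰` there is no Poisson process. -/
lemma IsPoissonProcess.dim_pos (hlam : 0 < lam) (hL : IsPoissonProcess P lam L) : 0 < d := by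
  rw [Nat.pos_iff_ne_zero]
  rintro rfl
  have h := congrArg (fun μ => μ {2}) (hL.law_count (cube 0 0) (measurableSet_cube 0 0)
    (by rw [volume_cube]; exact ENNReal.coe_lt_top))
  rw [Measure.map_apply (hL.measurable_count _ (measurableSet_cube 0 0))
    (measurableSet_singleton _), Measure.map_apply .of_discrete (measurableSet_singleton _),
    volume_cube, ENNReal.toNNReal_coe] at h
  -- A one-point space never holds two points, while a Poisson variable of positive mean equals `2`
  -- with positive probability.
  have h1 : count L (cube 0 0) ⁻¹' {2} = ∅ := by
    ext ω
    have : count L (cube 0 0) ω ≤ 1 := Set.encard_le_one_iff.2 fun a b _ _ => Subsingleton.elim a b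
    simp only [Set.mem_preimage, Set.mem_singleton_iff, Set.mem_empty_iff_false, iff_false]
    intro h2
    rw [h2] at this
    norm_num at this
  have h2 : (fun n : ℕ => (n : ℕ∞)) ⁻¹' {2} = {2} := by
    ext n
    simp only [Set.mem_preimage, Set.mem_singleton_iff]
    norm_cast
  rw [h1, h2, measure_empty] at h
  have h3 := poissonMeasure_real_singleton_pos 2 (mul_pos hlam (cubeVolume_pos 0 0))
  rw [measureReal_def] at h3
  simp [← h] at h3

end PoissonCubes

/-! ### A Poisson process contains no isosceles triangles -/

section Isosceles

variable {d : ℕ}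

/-- The indices of the cubes that contain a point at distance between `a` and `b` from some point
of the cube with index `u`. -/
def shellCells (m : ℕ) (u : Fin d → ℤ) (a b : ℝ) : Set (Fin d → ℤ) :=
  {v | ∃ x y, cell m x = u ∧ cell m y = v ∧ a ≤ dist x y ∧ dist x y ≤ b}

lemma finite_shellCells (m : ℕ) (u : Fin d → ℤ) (a b : ℝ) : (shellCells m u a b).Finite := by
  refine (finite_image_cell m (corner m u) (b + mesh d m)).subset ?_
  rintro v ⟨x, y, rfl, rfl, -, hb⟩
  refine ⟨y, ?_, rfl⟩
  rw [Metric.mem_closedBall']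
  linarith [dist_triangle (corner m (cell m x)) x y, dist_corner_cell_le m x]

/-- These cubes are disjoint and lie in a shell about the corner, widened by one mesh for moving `x`
to the corner and one for moving `y` within its cube. -/
lemma ncard_shellCells_mul_le (m : ℕ) (u : Fin d → ℤ) (a b : ℝ) :
    ((shellCells m u a b).ncard : ℝ≥0∞) * cubeVolume d m ≤
      volume (Metric.closedBall (corner m u) (b + 2 * mesh d m) \
        Metric.ball (corner m u) (a - 2 * mesh d m)) := by
  rw [Set.ncard_eq_toFinset_card _ (finite_shellCells m u a b)]
  refine card_mul_cubeVolume_le m _ fun v hv z hz => ?_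
  rw [Set.Finite.mem_toFinset] at hv
  obtain ⟨x, y, rfl, rfl, ha, hb⟩ := hv
  have h1 := dist_corner_cell_le m x
  have h2 : dist z y ≤ mesh d m := dist_le_mesh hz
  have h3 := dist_triangle (corner m (cell m x)) x y
  have h4 := dist_triangle (corner m (cell m x)) y z
  have h5 := dist_triangle_left x y (corner m (cell m x))
  have h6 := dist_triangle (corner m (cell m x)) z y
  rw [dist_comm] at h2
  rw [dist_comm z y] at h6
  constructor
  · rw [Metric.mem_closedBall']
    linarith
  · rw [Metric.mem_ball']
    linarith

/-- The bound is uniform in the scale `m`. It serves both to exclude isosceles triangles and to make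
the percolation subcritical. -/
lemma exists_volume_shellCells_le (hd : 0 < d) (R : ℝ) {η : ℝ≥0} (hη : 0 < η) :
    ∃ ε > 0, ∀ (m : ℕ) (u : Fin d → ℤ) (a b c : ℝ), c ∈ Set.Icc 0 R →
      c - ε ≤ a - 2 * mesh d m → b + 2 * mesh d m ≤ c + ε →
      ((shellCells m u a b).ncard : ℝ≥0∞) * cubeVolume d m ≤ η := by
  obtain ⟨ε, hε, h⟩ := exists_volume_shell_le hd R hη
  refine ⟨ε, hε, fun m u a b c hc ha hb => (ncard_shellCells_mul_le m u a b).trans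
    ((measure_mono ?_).trans (h (corner m u) c hc))⟩
  exact Set.sdiff_subset_sdiff (Metric.closedBall_subset_closedBall hb) (Metric.ball_subset_ball ha)

lemma eventually_cell_ne {x y : EuclideanSpace ℝ (Fin d)} (h : x ≠ y) :
    ∀ᶠ m in Filter.atTop, cell m x ≠ cell m y := by
  filter_upwards [(tendsto_mesh d).eventually_lt_const (dist_pos.2 h)] with m hm heq
  exact absurd (dist_le_mesh heq) (not_le.2 hm)

/-- The cubes with indices `u`, `v`, `w` could contain an isosceles triangle with apex in the first
cube. -/
def isoscelesCells (m : ℕ) (u v : Fin d → ℤ) : Set (Fin d → ℤ) :=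
  shellCells m u (dist (corner m u) (corner m v) - 2 * mesh d m)
    (dist (corner m u) (corner m v) + 2 * mesh d m)

lemma cell_mem_isoscelesCells (m : ℕ) {x y z : EuclideanSpace ℝ (Fin d)}
    (h : dist x y = dist x z) : cell m z ∈ isoscelesCells m (cell m x) (cell m y) := by
  have := abs_le.1 (abs_dist_corner_sub_dist_le m x y)
  exact ⟨x, z, rfl, rfl, by linarith [this.2], by linarith [this.1]⟩

variable {Ω : Type*} [MeasurableSpace Ω] {P : Measure Ω} {lam : ℝ≥0}
  {L : Ω → Set (EuclideanSpace ℝ (Fin d))}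

/-- The event that three distinct occupied cubes near the origin could contain an isosceles
triangle has small probability. -/
lemma exists_measure_isosceles_le (hd : 0 < d) (hL : IsPoissonProcess P lam L) (K : ℕ) {η : ℝ≥0}
    (hη : 0 < η) :
    ∃ m₀, ∀ m ≥ m₀, P {ω | ∃ u ∈ cell m '' Metric.closedBall 0 K, ∃ v ∈ cell m ''
        Metric.closedBall 0 K, ∃ w ∈ isoscelesCells m u v, u ≠ v ∧ u ≠ w ∧ v ≠ w ∧
        u ∈ occ m (L ω) ∧ v ∈ occ m (L ω) ∧ w ∈ occ m (L ω)} ≤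
      (lam * volume (Metric.closedBall (0 : EuclideanSpace ℝ (Fin d)) (K + 1))) ^ 2 *
        (lam * η) := by
  classical
  -- The corners involved lie within `K + 1` of the origin, so their distances are at most `2 * K +
  -- 2`.
  obtain ⟨ε, hε, hcard⟩ := exists_volume_shellCells_le hd (2 * K + 2) hη
  -- `isoscelesCells` allows an error of two meshes and the shell bound adds two more, hence `ε /
  -- 4`.
  obtain ⟨m₀, hm₀⟩ := Filter.eventually_atTop.1 ((tendsto_mesh d).eventually_lt_const
    (show 0 < min 1 (ε / 4) by positivity))
  refine ⟨m₀, fun m hm => ?_⟩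
  have hm1 : mesh d m < 1 := (hm₀ m hm).trans_le (min_le_left _ _)
  have hmε : mesh d m < ε / 4 := (hm₀ m hm).trans_le (min_le_right _ _)
  have hCfin := finite_image_cell m (0 : EuclideanSpace ℝ (Fin d)) K
  set C := hCfin.toFinset with hC
  set V := volume (Metric.closedBall (0 : EuclideanSpace ℝ (Fin d)) (K + 1))
  have hCV : (C.card : ℝ≥0∞) * cubeVolume d m ≤ V := by
    refine card_mul_cubeVolume_le m _ fun u hu z hz => ?_
    rw [hC, Set.Finite.mem_toFinset] at hu
    obtain ⟨x, hx, rfl⟩ := hu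
    have h2 : dist z x ≤ mesh d m := dist_le_mesh hz
    rw [Metric.mem_closedBall] at hx ⊢
    linarith [dist_triangle z x 0]
  have hCn : ∀ u ∈ C, dist (corner m u) 0 ≤ K + 1 := by
    intro u hu
    rw [hC, Set.Finite.mem_toFinset] at hu
    obtain ⟨x, hx, rfl⟩ := hu
    rw [Metric.mem_closedBall] at hx
    linarith [dist_triangle (corner m (cell m x)) x 0, dist_corner_cell_le m x]
  set p := occProb d lam m
  have hp : p ≤ lam * cubeVolume d m := occProb_le d lam m
  let T : (Fin d → ℤ) → (Fin d → ℤ) → Finset (Fin d → ℤ) := fun u v =>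
    (finite_shellCells m u (dist (corner m u) (corner m v) - 2 * mesh d m)
      (dist (corner m u) (corner m v) + 2 * mesh d m)).toFinset
  have hT : ∀ u ∈ C, ∀ v ∈ C, ((T u v).card : ℝ≥0∞) * cubeVolume d m ≤ η := by
    intro u hu v hv
    have h := hcard m u (dist (corner m u) (corner m v) - 2 * mesh d m)
      (dist (corner m u) (corner m v) + 2 * mesh d m) (dist (corner m u) (corner m v))
      ⟨dist_nonneg, by
        have h1 := dist_triangle_right (corner m u) (corner m v) 0
        linarith [hCn u hu, hCn v hv]⟩ (by linarith) (by linarith)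
    rwa [Set.ncard_eq_toFinset_card _ (finite_shellCells m u _ _)] at h
  have hsub : {ω | ∃ u ∈ cell m '' Metric.closedBall 0 K, ∃ v ∈ cell m ''
        Metric.closedBall 0 K, ∃ w ∈ isoscelesCells m u v, u ≠ v ∧ u ≠ w ∧ v ≠ w ∧
        u ∈ occ m (L ω) ∧ v ∈ occ m (L ω) ∧ w ∈ occ m (L ω)} ⊆
      ⋃ u ∈ C, ⋃ v ∈ C, ⋃ w ∈ T u v, {ω | (u ≠ v ∧ u ≠ w ∧ v ≠ w) ∧
        ∀ z ∈ ({u, v, w} : Finset _), z ∈ occ m (L ω)} := by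
    rintro ω ⟨u, hu, v, hv, w, hw, h1, h2, h3, h4, h5, h6⟩
    simp only [Set.mem_iUnion]
    refine ⟨u, hCfin.mem_toFinset.2 hu, v, hCfin.mem_toFinset.2 hv, w,
      (Set.Finite.mem_toFinset _).2 hw, ⟨h1, h2, h3⟩, ?_⟩
    simp [h4, h5, h6]
  have hone : ∀ u v w : Fin d → ℤ, P {ω | (u ≠ v ∧ u ≠ w ∧ v ≠ w) ∧
        ∀ z ∈ ({u, v, w} : Finset _), z ∈ occ m (L ω)} ≤ p ^ 3 := by
    intro u v w
    by_cases h : u ≠ v ∧ u ≠ w ∧ v ≠ w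
    · have hc : ({u, v, w} : Finset (Fin d → ℤ)).card = 3 := Finset.card_eq_three.2
        ⟨u, v, w, h.1, h.2.1, h.2.2, rfl⟩
      rw [← hc, ← hL.measure_subset_occ m]
      exact measure_mono fun ω hω => hω.2
    · simp [h]
  -- Each triple has probability at most `p ^ 3`. The three cube volumes cancel against the counts
  -- of `u`, `v` and `w`, so the bound no longer depends on `m`.
  calc _ ≤ ∑ u ∈ C, ∑ v ∈ C, ∑ w ∈ T u v, p ^ 3 := by
        refine (measure_mono hsub).trans ((measure_biUnion_finset_le _ _).trans
          (Finset.sum_le_sum fun u _ => (measure_biUnion_finset_le _ _).trans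
          (Finset.sum_le_sum fun v _ => (measure_biUnion_finset_le _ _).trans
          (Finset.sum_le_sum fun w _ => hone u v w))))
    _ ≤ ∑ u ∈ C, ∑ v ∈ C, p ^ 2 * (lam * η) := by
        refine Finset.sum_le_sum fun u hu => Finset.sum_le_sum fun v hv => ?_
        rw [Finset.sum_const, nsmul_eq_mul]
        calc ((T u v).card : ℝ≥0∞) * p ^ 3 = p ^ 2 * ((T u v).card * p) := by ring
          _ ≤ p ^ 2 * ((T u v).card * (lam * cubeVolume d m)) := by gcongr
          _ = p ^ 2 * (lam * ((T u v).card * cubeVolume d m)) := by ring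
          _ ≤ _ := by gcongr; exact hT u hu v hv
    _ = (C.card * p) ^ 2 * (lam * η) := by
        simp only [Finset.sum_const, nsmul_eq_mul]
        ring
    _ ≤ (C.card * (lam * cubeVolume d m)) ^ 2 * (lam * η) := by gcongr
    _ = (lam * (C.card * cubeVolume d m)) ^ 2 * (lam * η) := by ring
    _ ≤ _ := by gcongr

theorem IsPoissonProcess.ae_eq_of_dist_eq (hd : 0 < d) (hL : IsPoissonProcess P lam L) :
    ∀ᵐ ω ∂P, ∀ x ∈ L ω, ∀ y ∈ L ω, ∀ z ∈ L ω, dist x y = dist x z → y = z := by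
  -- `M` records a scale from which the three points occupy distinct cubes, so the estimate at a
  -- single fine scale bounds the whole event; only countably many `K`, `M` are needed.
  let bad : ℕ → ℕ → Set Ω := fun K M => {ω | ∃ x ∈ L ω, ∃ y ∈ L ω, ∃ z ∈ L ω,
    x ∈ Metric.closedBall 0 (K : ℝ) ∧ y ∈ Metric.closedBall 0 (K : ℝ) ∧ dist x y = dist x z ∧
    ∀ m ≥ M, cell m x ≠ cell m y ∧ cell m x ≠ cell m z ∧ cell m y ≠ cell m z}
  have hbad : ∀ K M, P (bad K M) = 0 := by
    intro K M
    set V := volume (Metric.closedBall (0 : EuclideanSpace ℝ (Fin d)) (K + 1)) with hV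
    have hVtop : V ≠ ⊤ := measure_closedBall_lt_top.ne
    have key : ∀ η : ℝ≥0, 0 < η → P (bad K M) ≤ (lam * V) ^ 2 * (lam * η) := by
      intro η hη
      obtain ⟨m₀, hm₀⟩ := exists_measure_isosceles_le hd hL K hη
      refine (measure_mono ?_).trans (hm₀ (max m₀ M) (le_max_left _ _))
      rintro ω ⟨x, hx, y, hy, z, hz, hxK, hyK, hdist, hm⟩
      obtain ⟨h1, h2, h3⟩ := hm (max m₀ M) (le_max_right _ _)
      exact ⟨_, ⟨x, hxK, rfl⟩, _, ⟨y, hyK, rfl⟩, _, cell_mem_isoscelesCells _ hdist, h1, h2, h3,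
        ⟨x, hx, rfl⟩, ⟨y, hy, rfl⟩, ⟨z, hz, rfl⟩⟩
    have hlim : Filter.Tendsto (fun n : ℕ => (lam * V) ^ 2 * (lam * ((n : ℝ≥0∞) + 1)⁻¹))
        Filter.atTop (nhds 0) := by
      have h0 : Filter.Tendsto (fun n : ℕ => ((n : ℝ≥0∞) + 1)⁻¹) Filter.atTop (nhds 0) := by
        have := (Filter.tendsto_add_atTop_iff_nat 1).2 ENNReal.tendsto_inv_nat_nhds_zero
        simpa using this
      have h1 := ENNReal.Tendsto.const_mul (a := (lam * V) ^ 2 * lam) h0 (Or.inr (by finiteness))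
      simpa [mul_assoc] using h1
    refine le_antisymm (ge_of_tendsto' hlim fun n => ?_) zero_le
    have := key ((n : ℝ≥0) + 1)⁻¹ (by positivity)
    rwa [ENNReal.coe_inv (by positivity), ENNReal.coe_add, ENNReal.coe_natCast,
      ENNReal.coe_one] at this
  have hall : ∀ᵐ ω ∂P, ∀ K M, ω ∉ bad K M := by
    rw [ae_all_iff]
    intro K
    rw [ae_all_iff]
    intro M
    exact measure_eq_zero_iff_ae_notMem.1 (hbad K M)
  filter_upwards [hall] with ω hω x hx y hy z hz hdist
  by_contra hyz
  have hxy : x ≠ y := by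
    rintro rfl
    rw [dist_self] at hdist
    exact hyz (dist_eq_zero.1 hdist.symm)
  have hxz : x ≠ z := by
    rintro rfl
    rw [dist_self] at hdist
    exact hxy (dist_eq_zero.1 hdist)
  obtain ⟨K, hK⟩ := exists_nat_ge (max (dist x 0) (dist y 0))
  obtain ⟨M, hM⟩ := Filter.eventually_atTop.1 ((eventually_cell_ne hxy).and
    ((eventually_cell_ne hxz).and (eventually_cell_ne hyz)))
  exact hω K M ⟨x, hx, y, hy, z, hz, (le_max_left _ _).trans hK, (le_max_right _ _).trans hK,
    hdist, hM⟩

end Isosceles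

/-! ### Subcritical site percolation -/

section Percolation

variable {V : Type*} [DecidableEq V]

/-- The lists of `n + 1` successive neighbours starting from `u`. -/
def walks (nbr : V → Finset V) : ℕ → V → Finset (List V)
  | 0, u => {[u]}
  | n + 1, u => (nbr u).biUnion fun w => (walks nbr n w).image fun l => u :: l

lemma cons_mem_walks {nbr : V → Finset V} {u : V} {l : List V}
    (h : (u :: l).IsChain fun a b => b ∈ nbr a) : u :: l ∈ walks nbr l.length u := by
  induction l generalizing u with
  | nil => simp [walks]
  | cons w l ih =>
    rw [List.isChain_cons_cons] at h
    simp only [List.length_cons, walks, Finset.mem_biUnion, Finset.mem_image]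
    exact ⟨w, h.1, w :: l, ih h.2, rfl⟩

lemma length_of_mem_walks {nbr : V → Finset V} {n : ℕ} {u : V} {l : List V}
    (h : l ∈ walks nbr n u) : l.length = n + 1 := by
  induction n generalizing u l with
  | zero =>
    simp only [walks, Finset.mem_singleton] at h
    simp [h]
  | succ n ih =>
    simp only [walks, Finset.mem_biUnion, Finset.mem_image] at h
    obtain ⟨w, -, l, hl, rfl⟩ := h
    simp [ih hl]

/-- Each step multiplies the count by at most the degree, which together with one factor `p` costs
at most `1/2`. -/
lemma card_walks_mul_pow_le {nbr : V → Finset V} {p : ℝ≥0∞}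
    (h : ∀ u, ((nbr u).card : ℝ≥0∞) * p ≤ 2⁻¹) (n : ℕ) (u : V) :
    ((walks nbr n u).card : ℝ≥0∞) * p ^ n ≤ 2⁻¹ ^ n := by
  induction n generalizing u with
  | zero => simp [walks]
  | succ n ih =>
    calc ((walks nbr (n + 1) u).card : ℝ≥0∞) * p ^ (n + 1)
        ≤ (∑ w ∈ nbr u, (walks nbr n w).card : ℕ) * p ^ (n + 1) := by
          gcongr
          exact Finset.card_biUnion_le.trans (Finset.sum_le_sum fun w _ => Finset.card_image_le)
      _ = (∑ w ∈ nbr u, (walks nbr n w).card * p ^ n) * p := by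
          rw [Nat.cast_sum, ← Finset.sum_mul]
          ring
      _ ≤ (∑ w ∈ nbr u, 2⁻¹ ^ n) * p := by
          gcongr with w
          exact ih w
      _ = ((nbr u).card * p) * 2⁻¹ ^ n := by
          rw [Finset.sum_const, nsmul_eq_mul]
          ring
      _ ≤ 2⁻¹ * 2⁻¹ ^ n := by gcongr; exact h u
      _ = 2⁻¹ ^ (n + 1) := by ring

/-- Loop erasure: if the new head already occurs in the path, keep only the part from that
occurrence. The `getLast?` clause guarantees that the cut does not lose `v`. -/
lemma exists_nodup_chain {R : V → V → Prop} {u v : V} (h : Relation.ReflTransGen R u v) :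
    ∃ l : List V, (u :: l).Nodup ∧ (u :: l).IsChain R ∧ v ∈ u :: l ∧
      (u :: l).getLast? = some v := by
  induction h using Relation.ReflTransGen.head_induction_on with
  | refl => exact ⟨[], by simp⟩
  | @head u w huw _ ih =>
    obtain ⟨l, hnd, hch, hmem, hlast⟩ := ih
    by_cases hu : u ∈ w :: l
    · obtain ⟨s, t, hst⟩ := List.append_of_mem hu
      rw [hst] at hnd hch hlast
      rw [List.getLast?_append_of_ne_nil _ (by simp)] at hlast
      exact ⟨t, (List.nodup_append.1 hnd).2.1, hch.right_of_append,
        List.mem_of_getLast? hlast, hlast⟩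
    · refine ⟨w :: l, List.nodup_cons.2 ⟨hu, hnd⟩, List.isChain_cons_cons.2 ⟨huw, hch⟩,
        List.mem_cons_of_mem _ hmem, ?_⟩
      rw [List.getLast?_cons_cons]
      exact hlast

/-- If there is no long self-avoiding walk from `u` in `X`, then the cluster of `u` is finite. -/
lemma finite_cluster_of_no_walk {nbr : V → Finset V} {X : Set V} {u : V} (hu : u ∈ X) (n : ℕ)
    (h : ∀ l ∈ walks nbr n u, l.Nodup → ¬ ∀ v ∈ l, v ∈ X) :
    {v | Relation.ReflTransGen (fun a b => b ∈ nbr a ∧ b ∈ X) u v}.Finite := by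
  refine (Finset.finite_toSet ((Finset.range n).biUnion fun j =>
    (walks nbr j u).biUnion List.toFinset)).subset fun v hv => ?_
  obtain ⟨l, hnd, hch, hmem, -⟩ := exists_nodup_chain hv
  have hX : ∀ w ∈ u :: l, w ∈ X := by
    have : ∀ (l : List V) (u : V), u ∈ X →
        (u :: l).IsChain (fun a b => b ∈ nbr a ∧ b ∈ X) → ∀ w ∈ u :: l, w ∈ X := by
      intro l
      induction l with
      | nil => simp
      | cons a l ih =>
        intro u hu h w hw
        rw [List.isChain_cons_cons] at h
        rcases List.mem_cons.1 hw with rfl | hw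
        · exact hu
        · exact ih a h.1.2 h.2 w hw
    exact this l u hu hch
  have hch' : (u :: l).IsChain fun a b => b ∈ nbr a := hch.imp fun _ _ h => h.1
  -- A longer self-avoiding path would have an initial segment of `n + 1` vertices, which is
  -- excluded.
  by_cases hlen : l.length < n
  · simp only [Finset.coe_biUnion, Set.mem_iUnion, Finset.mem_coe, List.mem_toFinset,
      Finset.mem_range]
    exact ⟨l.length, hlen, u :: l, cons_mem_walks hch', hmem⟩
  · exfalso
    have htake : u :: l.take n = (u :: l).take (n + 1) := by simp
    have hlt : (l.take n).length = n := by simp; omega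
    have h1 := cons_mem_walks (nbr := nbr) (u := u) (l := l.take n)
      (by rw [htake]; exact hch'.take _)
    rw [hlt] at h1
    refine h _ h1 ?_ fun w hw => hX w ?_
    · rw [htake]
      exact hnd.sublist (List.take_sublist _ _)
    · rw [htake] at hw
      exact List.mem_of_mem_take hw

variable {Ω : Type*} [MeasurableSpace Ω] {P : Measure Ω}

/-- First-moment bound: an infinite cluster forces an occupied self-avoiding walk of every length,
and the expected number of these with `n + 1` vertices is at most `2⁻¹ ^ n`. Self-avoidance makes
the vertices distinct, so `hX` gives the full power of `p`. -/
theorem ae_finite_cluster [Countable V] {nbr : V → Finset V} {X : Ω → Set V} {p : ℝ≥0∞}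
    (hp : p ≤ 1) (hX : ∀ s : Finset V, P {ω | ∀ u ∈ s, u ∈ X ω} ≤ p ^ s.card)
    (h : ∀ u, ((nbr u).card : ℝ≥0∞) * p ≤ 2⁻¹) :
    ∀ᵐ ω ∂P, ∀ u ∈ X ω,
      {v | Relation.ReflTransGen (fun a b => b ∈ nbr a ∧ b ∈ X ω) u v}.Finite := by
  rw [ae_all_iff]
  intro u
  have hle : ∀ n, P {ω | ¬ (u ∈ X ω →
      {v | Relation.ReflTransGen (fun a b => b ∈ nbr a ∧ b ∈ X ω) u v}.Finite)} ≤ 2⁻¹ ^ n := by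
    intro n
    have hsub : {ω | ¬ (u ∈ X ω →
        {v | Relation.ReflTransGen (fun a b => b ∈ nbr a ∧ b ∈ X ω) u v}.Finite)} ⊆
        ⋃ l ∈ walks nbr n u, {ω | l.Nodup ∧ ∀ v ∈ l.toFinset, v ∈ X ω} := by
      intro ω hω
      rw [Set.mem_ofPred_eq, Classical.not_imp] at hω
      by_contra hno
      refine hω.2 (finite_cluster_of_no_walk hω.1 n fun l hl hnd hlX => hno ?_)
      simp only [Set.mem_iUnion]
      exact ⟨l, hl, hnd, fun v hv => hlX v (List.mem_toFinset.1 hv)⟩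
    calc _ ≤ ∑ l ∈ walks nbr n u, P {ω | l.Nodup ∧ ∀ v ∈ l.toFinset, v ∈ X ω} :=
          (measure_mono hsub).trans (measure_biUnion_finset_le _ _)
      _ ≤ ∑ l ∈ walks nbr n u, p ^ n := by
          refine Finset.sum_le_sum fun l hl => ?_
          by_cases hnd : l.Nodup
          · have hc : l.toFinset.card = n + 1 := by
              rw [List.toFinset_card_of_nodup hnd, length_of_mem_walks hl]
            refine (measure_mono fun ω hω => hω.2).trans ((hX l.toFinset).trans ?_)
            rw [hc]
            exact pow_le_pow_right_of_le_one' hp (Nat.le_succ n)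
          · simp [hnd]
      _ ≤ 2⁻¹ ^ n := by
          rw [Finset.sum_const, nsmul_eq_mul]
          exact card_walks_mul_pow_le h n u
  refine le_antisymm (ge_of_tendsto' (ENNReal.tendsto_pow_atTop_nhds_zero_of_lt_one ?_) hle) zero_le
  simp

end Percolation

/-! ### Friendly frogs on a Poisson process stops -/

section Termination

variable {d : ℕ}

/-- The cubes reachable from the cube `u` by jumps between occupied cubes with lengths between
`a` and `b`. -/
def cluster (m : ℕ) (L : Set (EuclideanSpace ℝ (Fin d))) (a b : ℝ) (u : Fin d → ℤ) :
    Set (Fin d → ℤ) :=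
  {v | Relation.ReflTransGen (fun v w => w ∈ shellCells m v a b ∧ w ∈ occ m L) u v}

/-- The distance between the two frogs. -/
noncomputable def sym2Dist {E : Type*} [MetricSpace E] : Sym2 E → ℝ :=
  Sym2.lift ⟨fun x y => dist x y, dist_comm⟩

lemma FrogMove.sym2Dist_lt {E : Type*} [MetricSpace E] {L : Set E} {s t : Sym2 E}
    (h : FrogMove L s t) : sym2Dist t < sym2Dist s := by
  obtain ⟨x, hx, y, hy, z, hz, hxy, hxz, rfl, rfl, h⟩ := h
  exact h

/-- Along an infinite play the distance eventually stays in one window of width `ε`. From then on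
both frogs stay in cubes of a single finite cluster, so finitely many pairs remain, yet strictly
decreasing distances make all pairs different. -/
lemma wellFounded_frogMove {L : Set (EuclideanSpace ℝ (Fin d))}
    (hfin : ∀ x r, (L ∩ Metric.closedBall x r).Finite)
    (hcl : ∀ R : ℕ, ∃ ε > (0 : ℝ), ∃ m, ∀ j : ℕ, j * ε ≤ R →
      ∀ u ∈ occ m L, (cluster m L (j * ε) (j * ε + ε) u).Finite) :
    WellFounded fun t s => FrogMove L s t := by
  rw [wellFounded_iff_isEmpty_descending_chain]
  refine ⟨fun ⟨f, hf⟩ => ?_⟩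
  have hf : ∀ n, FrogMove L (f n) (f (n + 1)) := hf
  have hanti : StrictAnti fun n => sym2Dist (f n) := strictAnti_nat_of_succ_lt fun n =>
    (hf n).sym2Dist_lt
  have hnonneg : ∀ s : Sym2 (EuclideanSpace ℝ (Fin d)), 0 ≤ sym2Dist s := by
    intro s
    induction s using Sym2.ind with
    | _ x y => exact dist_nonneg (x := x) (y := y)
  obtain ⟨R, hR⟩ := exists_nat_ge (sym2Dist (f 0))
  obtain ⟨ε, hε, m, hcl⟩ := hcl R
  let g : ℕ → ℕ := fun n => ⌊sym2Dist (f n) / ε⌋₊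
  have hg : Antitone g := fun a b hab => Nat.floor_le_floor
    (div_le_div_of_nonneg_right (hanti.antitone hab) hε.le)
  obtain ⟨N, hN⟩ : ∃ N, ∀ n, g N ≤ g n := by
    obtain ⟨_, ⟨N, rfl⟩, h⟩ := wellFounded_lt.has_min (Set.range g) ⟨_, ⟨0, rfl⟩⟩
    exact ⟨N, fun n => not_lt.1 (h _ ⟨n, rfl⟩)⟩
  have hgN : ∀ n ≥ N, g n = g N := fun n hn => le_antisymm (hg hn) (hN n)
  have hlow : ∀ n ≥ N, g N * ε ≤ sym2Dist (f n) := by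
    intro n hn
    rw [← hgN n hn, ← le_div_iff₀ hε]
    exact Nat.floor_le (div_nonneg (hnonneg _) hε.le)
  have hhigh : ∀ n ≥ N, sym2Dist (f n) ≤ g N * ε + ε := by
    intro n hn
    rw [← hgN n hn, ← add_one_mul, ← div_le_iff₀ hε]
    exact (Nat.lt_floor_add_one _).le
  obtain ⟨x₀, hx₀, y₀, hy₀, hxy₀, hfN⟩ := (hf N).isFrogPair
  have hC := hcl (g N) ((hlow N le_rfl).trans ((hanti.antitone (Nat.zero_le N)).trans hR))
    (cell m x₀) ⟨x₀, hx₀, rfl⟩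
  set C := cluster m L (g N * ε) (g N * ε + ε) (cell m x₀) with hCdef
  have hstep : ∀ n ≥ N, ∀ x y, f n = s(x, y) → cell m x ∈ C → y ∈ L → cell m y ∈ C := by
    intro n hn x y hfn hx hy
    have h1 := hlow n hn
    have h2 := hhigh n hn
    rw [hfn] at h1 h2
    exact Relation.ReflTransGen.tail hx ⟨⟨x, y, rfl, rfl, h1, h2⟩, ⟨y, hy, rfl⟩⟩
  -- The frog that stays put is already in `C`, and the other lands at a distance from it lying in
  -- the window.
  have hmem : ∀ n, ∀ z ∈ f (N + n), z ∈ L ∧ cell m z ∈ C := by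
    intro n
    induction n with
    | zero =>
      intro z hz
      rw [add_zero, hfN, Sym2.mem_iff] at hz
      have hx₀C : cell m x₀ ∈ C := Relation.ReflTransGen.refl
      rcases hz with rfl | rfl
      · exact ⟨hx₀, hx₀C⟩
      · exact ⟨hy₀, hstep N le_rfl x₀ z hfN hx₀C hy₀⟩
    | succ n ih =>
      obtain ⟨x, hx, y, hy, z, hz, hxy, hxz, hs, ht, -⟩ := hf (N + n)
      have hxC := (ih x (by rw [hs]; exact Sym2.mem_mk_left x y)).2
      intro w hw
      rw [← add_assoc, ht, Sym2.mem_iff] at hw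
      rcases hw with rfl | rfl
      · exact ⟨hx, hxC⟩
      · exact ⟨hz, hstep (N + n + 1) (by omega) x w ht hxC hz⟩
  have hZ : (⋃ u ∈ C, L ∩ cube m u).Finite := by
    refine hC.biUnion fun u _ => (hfin (corner m u) (mesh d m)).subset fun x hx => ⟨hx.1, ?_⟩
    exact dist_le_mesh (hx.2.trans (cell_corner m u).symm)
  refine Set.infinite_range_of_injective (f := fun n => f (N + n)) (fun a b hab => ?_)
    (((hZ.prod hZ).image fun p => s(p.1, p.2)).subset ?_)
  · exact Nat.add_left_cancel (hanti.injective (congrArg sym2Dist hab))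
  · rintro _ ⟨n, rfl⟩
    have h := hmem n
    simp only
    generalize f (N + n) = s at h ⊢
    induction s using Sym2.ind with
    | _ x y =>
      obtain ⟨hxL, hxC⟩ := h x (Sym2.mem_mk_left x y)
      obtain ⟨hyL, hyC⟩ := h y (Sym2.mem_mk_right x y)
      exact ⟨(x, y), ⟨Set.mem_biUnion hxC ⟨hxL, rfl⟩, Set.mem_biUnion hyC ⟨hyL, rfl⟩⟩, rfl⟩

variable {Ω : Type*} [MeasurableSpace Ω] {P : Measure Ω} {lam : ℝ≥0}
  {L : Ω → Set (EuclideanSpace ℝ (Fin d))}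

lemma IsPoissonProcess.exists_ae_finite_cluster (hd : 0 < d) (hlam : 0 < lam)
    (hL : IsPoissonProcess P lam L) (R : ℕ) :
    ∃ ε : ℝ, 0 < ε ∧ ∃ m, ∀ j : ℕ, j * ε ≤ R → ∀ᵐ ω ∂P,
      ∀ u ∈ occ m (L ω), (cluster m (L ω) (j * ε) (j * ε + ε) u).Finite := by
  classical
  -- With volume at most `(2 * lam)⁻¹` the expected number of occupied neighbours is at most `1/2`.
  obtain ⟨ε, hε, h⟩ := exists_volume_shellCells_le hd R (show 0 < (2 * lam)⁻¹ by positivity)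
  obtain ⟨m, hm⟩ := ((tendsto_mesh d).eventually_lt_const (show 0 < ε / 4 by positivity)).exists
  have hm0 := mesh_nonneg d m
  -- A window of width `ε / 2` leaves room for the two meshes, each below `ε / 4`.
  refine ⟨ε / 2, by positivity, m, fun j hj => ?_⟩
  have hp1 : occProb d lam m ≤ 1 := prob_le_one
  have key := ae_finite_cluster (P := P) (X := fun ω => occ m (L ω)) (p := occProb d lam m)
    (nbr := fun u => (finite_shellCells m u (j * (ε / 2)) (j * (ε / 2) + ε / 2)).toFinset) hp1
    (fun s => (hL.measure_subset_occ m s).le) fun u => ?_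
  · filter_upwards [key] with ω hω u hu
    simpa only [cluster, Set.Finite.mem_toFinset] using hω u hu
  · rw [← Set.ncard_eq_toFinset_card _ (finite_shellCells m u _ _)]
    have h1 := h m u (j * (ε / 2)) (j * (ε / 2) + ε / 2) (j * (ε / 2)) ⟨by positivity, hj⟩
      (by linarith) (by linarith)
    set N := (shellCells m u (j * (ε / 2)) (j * (ε / 2) + ε / 2)).ncard
    calc (N : ℝ≥0∞) * occProb d lam m ≤ N * (lam * cubeVolume d m) := by
          gcongr
          exact occProb_le d lam m
      _ = lam * (N * cubeVolume d m) := by ring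
      _ ≤ lam * ((2 * lam)⁻¹ : ℝ≥0) := by gcongr
      _ = 2⁻¹ := by
          rw [← ENNReal.coe_mul, mul_inv, mul_left_comm, mul_inv_cancel₀ hlam.ne', mul_one]
          simp

theorem IsPoissonProcess.ae_isTame (hlam : 0 < lam) (hL : IsPoissonProcess P lam L) :
    ∀ᵐ ω ∂P, IsTame (L ω) := by
  have hd := hL.dim_pos hlam
  choose ε hε m h using hL.exists_ae_finite_cluster hd hlam
  have h' : ∀ᵐ ω ∂P, ∀ R j : ℕ, j * ε R ≤ R →
      ∀ u ∈ occ (m R) (L ω), (cluster (m R) (L ω) (j * ε R) (j * ε R + ε R) u).Finite := by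
    rw [ae_all_iff]
    intro R
    rw [ae_all_iff]
    intro j
    by_cases hj : j * ε R ≤ R
    · filter_upwards [h R j hj] with ω hω _ using hω
    · exact Filter.Eventually.of_forall fun ω hj' => absurd hj' hj
  filter_upwards [h', hL.ae_finite_inter, hL.ae_eq_of_dist_eq hd] with ω h1 h2 h3
  exact ⟨h2, h3, wellFounded_frogMove h2 fun R => ⟨ε R, hε R, m R, h1 R⟩⟩

end Termination

/-! ### Friendly frogs on the lattice -/

section Lattice

variable {d : ℕ}

/-- The squared Euclidean distance of two lattice points. -/
def sqDist (u v : Fin d → ℤ) : ℕ := ∑ i, (u i - v i).natAbs ^ 2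

lemma sqDist_comm (u v : Fin d → ℤ) : sqDist u v = sqDist v u :=
  Finset.sum_congr rfl fun i _ => by rw [← Int.natAbs_neg, neg_sub]

lemma sqDist_add_right (u v w : Fin d → ℤ) : sqDist (u + w) (v + w) = sqDist u v := by
  simp [sqDist]

lemma dist_corner (m : ℕ) (u v : Fin d → ℤ) :
    dist (corner m u) (corner m v) = √(sqDist u v) / 2 ^ m := by
  have h2 : (0 : ℝ) ≤ 2 ^ m := by positivity
  rw [EuclideanSpace.dist_eq, ← Real.sqrt_sq h2, ← Real.sqrt_div (by positivity)]
  congr 1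
  simp only [corner, Real.dist_eq, sq_abs, sqDist, Nat.cast_sum, Nat.cast_pow, Nat.cast_natAbs,
    Int.cast_abs, Finset.sum_div]
  exact Finset.sum_congr rfl fun i _ => by
    rw [← sub_div, div_pow]
    simp

lemma sqDist_lt_iff (m : ℕ) (u v u' v' : Fin d → ℤ) :
    sqDist u v < sqDist u' v' ↔
      dist (corner m u) (corner m v) < dist (corner m u') (corner m v') := by
  rw [dist_corner, dist_corner, div_lt_div_iff_of_pos_right (by positivity),
    Real.sqrt_lt_sqrt_iff (Nat.cast_nonneg _), Nat.cast_lt]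

/-- The label of the pair `u`, `v` for friendly frogs on the set `B` of lattice points. -/
noncomputable def latticeLabel (B : Set (Fin d → ℤ)) (u v : Fin d → ℤ) : ℕ :=
  sInf {n | (∀ z, z ∈ B → z ≠ u → sqDist u z < sqDist u v → latticeLabel B u z ≠ n) ∧
    ∀ z, z ∈ B → z ≠ v → sqDist v z < sqDist v u → latticeLabel B v z ≠ n}
termination_by sqDist u v
decreasing_by
  · assumption
  · rw [sqDist_comm u v]
    assumption

lemma measurable_sInf_nat : Measurable (sInf : Set ℕ → ℕ) := by
  refine measurable_to_countable' fun n => ?_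
  -- The second alternative accounts for `sInf ∅ = 0`.
  have h : (sInf : Set ℕ → ℕ) ⁻¹' {n} = {S | (n ∈ S ∧ ∀ k < n, k ∉ S) ∨ (n = 0 ∧ ∀ k, k ∉ S)} := by
    ext S
    simp only [Set.mem_preimage, Set.mem_singleton_iff, Set.mem_ofPred_eq]
    constructor
    · rintro rfl
      rcases S.eq_empty_or_nonempty with rfl | hS
      · right
        simp
      · exact Or.inl ⟨Nat.sInf_mem hS, fun k hk => Nat.notMem_of_lt_sInf hk⟩
    · rintro (⟨h1, h2⟩ | ⟨rfl, h⟩)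
      · exact le_antisymm (Nat.sInf_le h1) (not_lt.1 fun hlt => h2 _ hlt (Nat.sInf_mem ⟨n, h1⟩))
      · rw [Set.eq_empty_iff_forall_notMem.2 h, Nat.sInf_empty]
  rw [h]
  refine measurableSet_setOfPred.2 ?_
  have hm := fun k : ℕ => measurable_set_mem k
  have hn := fun k : ℕ => measurable_set_notMem k
  exact ((hm n).and (Measurable.forall fun k => Measurable.forall fun _ => hn k)).or
    (measurable_const.and (Measurable.forall hn))

/-- A purpose of the lattice: each step of the recursion on `sqDist` quantifies over countably many
sites only. -/
lemma measurable_latticeLabel (u v : Fin d → ℤ) : Measurable fun B => latticeLabel B u v := by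
  induction hN : sqDist u v using Nat.strong_induction_on generalizing u v with
  | _ N ih =>
    subst hN
    have h : (fun B => latticeLabel B u v) = fun B => sInf {n |
        (∀ z, z ∈ B → z ≠ u → sqDist u z < sqDist u v → latticeLabel B u z ≠ n) ∧
        ∀ z, z ∈ B → z ≠ v → sqDist v z < sqDist v u → latticeLabel B v z ≠ n} := by
      ext B
      rw [latticeLabel]
    rw [h]
    refine measurable_sInf_nat.comp (measurable_set_iff.2 fun n => ?_)
    simp only [Set.mem_ofPred_eq]
    refine Measurable.and ?_ ?_
    · refine Measurable.forall fun z => (measurable_set_mem z).imp (measurable_const.imp ?_)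
      by_cases hz : sqDist u z < sqDist u v
      · simp only [hz, true_imp_iff]
        exact measurableSet_setOfPred.1 (ih _ hz u z rfl (measurableSet_singleton n).compl)
      · simp only [hz, false_imp_iff]
        exact measurable_const
    · refine Measurable.forall fun z => (measurable_set_mem z).imp (measurable_const.imp ?_)
      by_cases hz : sqDist v z < sqDist v u
      · simp only [hz, true_imp_iff]
        rw [sqDist_comm v u] at hz
        exact measurableSet_setOfPred.1 (ih _ hz v z rfl (measurableSet_singleton n).compl)
      · simp only [hz, false_imp_iff]
        exact measurable_const

lemma latticeLabel_preimage_add (B : Set (Fin d → ℤ)) (w u v : Fin d → ℤ) :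
    latticeLabel ((· + w) ⁻¹' B) u v = latticeLabel B (u + w) (v + w) := by
  induction hN : sqDist u v using Nat.strong_induction_on generalizing u v with
  | _ N ih =>
    subst hN
    rw [latticeLabel, latticeLabel]
    congr 1
    ext n
    simp only [Set.mem_ofPred_eq, Set.mem_preimage]
    refine and_congr ?_ ?_
    · refine Iff.trans ?_ (Equiv.addRight w).surjective.forall.symm
      simp only [Equiv.coe_addRight, sqDist_add_right, ne_eq, add_left_inj]
      refine forall_congr' fun z => forall_congr' fun _ => forall_congr' fun _ =>
        forall_congr' fun hz => ?_
      rw [ih _ hz u z rfl]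
    · refine Iff.trans ?_ (Equiv.addRight w).surjective.forall.symm
      simp only [Equiv.coe_addRight, sqDist_add_right, ne_eq, add_left_inj]
      refine forall_congr' fun z => forall_congr' fun _ => forall_congr' fun _ =>
        forall_congr' fun hz => ?_
      rw [sqDist_comm v u] at hz
      rw [ih _ hz v z rfl]

/-- The index of the unit cube that contains the cube of side `2⁻ᵐ` with index `u`. -/
def unitCell (m : ℕ) (u : Fin d → ℤ) : Fin d → ℤ := fun i => u i / ((2 ^ m : ℕ) : ℤ)

lemma unitCell_cell (m : ℕ) (x : EuclideanSpace ℝ (Fin d)) : unitCell m (cell m x) = cell 0 x := by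
  ext i
  have := Int.natCast_mul_floor_div_cancel (n := 2 ^ m) (by positivity) (x i)
  push_cast at this
  simp [unitCell, cell, this]

lemma unitCell_add (m : ℕ) (u q : Fin d → ℤ) :
    unitCell m (u + fun i => q i * ((2 ^ m : ℕ) : ℤ)) = unitCell m u + q := by
  ext i
  exact Int.add_mul_ediv_right _ _ (by positivity)

/-- Some point of `B` in the unit cube `q` has no partner with label `n` near `q`. -/
def LatticeUnmatched (m n R : ℕ) (q : Fin d → ℤ) (B : Set (Fin d → ℤ)) : Prop :=
  ∃ u, (u ∈ B ∧ unitCell m u = q) ∧ ∀ v, v ∈ B → v ≠ u →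
    (∀ i, |unitCell m v i - q i| ≤ R) → latticeLabel B u v ≠ n

lemma measurable_latticeUnmatched (m n R : ℕ) (q : Fin d → ℤ) :
    Measurable (LatticeUnmatched m n R q) := by
  refine Measurable.exists fun u => ((measurable_set_mem u).and measurable_const).and
    (Measurable.forall fun v => (measurable_set_mem v).imp (measurable_const.imp
      (measurable_const.imp ?_)))
  exact measurableSet_setOfPred.1 (measurable_latticeLabel u v (measurableSet_singleton n).compl)

/-- Shifting by `2 ^ m` lattice steps per unit moves whole unit cubes, carrying the event at `q` to
the event at the origin. -/
lemma latticeUnmatched_preimage_add (m n R : ℕ) (q : Fin d → ℤ) (B : Set (Fin d → ℤ)) :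
    LatticeUnmatched m n R 0 ((· + fun i => q i * ((2 ^ m : ℕ) : ℤ)) ⁻¹' B) ↔
      LatticeUnmatched m n R q B := by
  unfold LatticeUnmatched
  refine Iff.trans ?_ (Equiv.addRight fun i => q i * ((2 ^ m : ℕ) : ℤ)).surjective.exists.symm
  refine exists_congr fun u => and_congr ?_ (Iff.trans ?_
    (Equiv.addRight fun i => q i * ((2 ^ m : ℕ) : ℤ)).surjective.forall.symm)
  all_goals simp only [Equiv.coe_addRight, unitCell_add, latticeLabel_preimage_add,
    Set.mem_preimage, ne_eq, add_left_inj, add_eq_right, Pi.add_apply, add_sub_cancel_right,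
    Pi.zero_apply, sub_zero]

end Lattice

/-! ### Discretization -/

section Discretization

variable {d : ℕ} {L : Set (EuclideanSpace ℝ (Fin d))}

/-- Finitely many `z` lie within `c + 1` of `x`, and the others keep a gap above `1`. The factor `4`
covers the comparison of two distances, each distorted by at most two meshes. -/
lemma eventually_mesh_lt_abs (hfin : ∀ x r, (L ∩ Metric.closedBall x r).Finite)
    (x y : EuclideanSpace ℝ (Fin d)) (c : ℝ) (h : ∀ z ∈ L, z ≠ y → dist x z ≠ c) :
    ∀ᶠ m in Filter.atTop, ∀ z ∈ L, z ≠ y → 4 * mesh d m < |dist x z - c| := by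
  have hm : Filter.Tendsto (fun m => 4 * mesh d m) Filter.atTop (nhds 0) := by
    simpa using (tendsto_mesh d).const_mul 4
  have h1 : ∀ᶠ m in Filter.atTop, ∀ z ∈ L ∩ Metric.closedBall x (c + 1), z ≠ y →
      4 * mesh d m < |dist x z - c| := by
    rw [Filter.eventually_all_finite (hfin x (c + 1))]
    intro z hz
    by_cases hzy : z = y
    · simp [hzy]
    · filter_upwards [hm.eventually_lt_const (abs_pos.2 (sub_ne_zero.2 (h z hz.1 hzy)))] with m hm _
        using hm
  filter_upwards [h1, hm.eventually_lt_const one_pos] with m h1 h2 z hz hzy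
  by_cases hzx : dist x z ≤ c + 1
  · exact h1 z ⟨hz, by rwa [Metric.mem_closedBall']⟩ hzy
  · exact h2.trans (lt_of_lt_of_le (by linarith) (le_abs_self _))

lemma eventually_cell_closer_iff (hL : IsTame L) {x y : EuclideanSpace ℝ (Fin d)} (hx : x ∈ L)
    (hy : y ∈ L) : ∀ᶠ m in Filter.atTop, ∀ z ∈ L,
      (cell m z ≠ cell m x ∧ sqDist (cell m x) (cell m z) < sqDist (cell m x) (cell m y)) ↔
        (z ≠ x ∧ dist x z < dist x y) := by
  filter_upwards [eventually_mesh_lt_abs hL.finite_inter x y (dist x y) fun z hz hzy h =>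
    hzy (hL.eq_of_dist_eq x hx z hz y hy h), eventually_mesh_lt_abs hL.finite_inter x x 0
    fun z _ hzx h => hzx (dist_eq_zero.1 h).symm] with m h1 h2 z hz
  have ez := abs_le.1 (abs_dist_corner_sub_dist_le m x z)
  have ey := abs_le.1 (abs_dist_corner_sub_dist_le m x y)
  have hm := mesh_nonneg d m
  rw [sqDist_lt_iff m]
  constructor
  · rintro ⟨hne, hlt⟩
    have hzx : z ≠ x := fun h => hne (by rw [h])
    have hzy : z ≠ y := fun h => hlt.ne (by rw [h])
    refine ⟨hzx, not_le.1 fun hle => ?_⟩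
    have := h1 z hz hzy
    rw [abs_of_nonneg (sub_nonneg.2 hle)] at this
    linarith [ez.1, ey.2]
  · rintro ⟨hzx, hlt⟩
    have hzy : z ≠ y := fun h => hlt.ne (by rw [h])
    refine ⟨fun h => ?_, ?_⟩
    · have h3 := dist_le_mesh h
      have h4 := h2 z hz hzx
      rw [sub_zero, abs_of_nonneg dist_nonneg, dist_comm] at h4
      linarith
    · have := h1 z hz hzy
      rw [abs_of_neg (sub_neg.2 hlt)] at this
      linarith [ez.2, ey.1]

/-- The labels of the discretized game converge to those of the original game. -/
lemma eventually_latticeLabel_eq (hL : IsTame L) {G : Sym2 (EuclideanSpace ℝ (Fin d)) → ℕ}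
    (hG : IsGrundyLabelling L G) {x y : EuclideanSpace ℝ (Fin d)} (hx : x ∈ L) (hy : y ∈ L)
    (hxy : x ≠ y) :
    ∀ᶠ m in Filter.atTop, latticeLabel (occ m L) (cell m x) (cell m y) = G s(x, y) := by
  suffices key : ∀ s, ∀ x ∈ L, ∀ y ∈ L, x ≠ y → s = s(x, y) →
      ∀ᶠ m in Filter.atTop, latticeLabel (occ m L) (cell m x) (cell m y) = G s(x, y) from
    key _ x hx y hy hxy rfl
  intro s
  induction s using hL.wf.induction with
  | _ s ih =>
    rintro x hx y hy hxy rfl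
    have hfin : ∀ a b : EuclideanSpace ℝ (Fin d), {z | z ∈ L ∧ z ≠ a ∧ dist a z < dist a b}.Finite :=
      fun a b => (hL.finite_inter a (dist a b)).subset fun z hz =>
        ⟨hz.1, by rw [Metric.mem_closedBall']; exact hz.2.2.le⟩
    have ih1 := (Filter.eventually_all_finite (hfin x y)).2 fun z hz =>
      ih s(x, z) ((frogMove_mk_iff hx hy hxy _).2 (Or.inl ⟨z, hz.1, hz.2.1, hz.2.2, rfl⟩))
        x hx z hz.1 hz.2.1.symm rfl
    have ih2 := (Filter.eventually_all_finite (hfin y x)).2 fun z hz =>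
      ih s(y, z) ((frogMove_mk_iff hx hy hxy _).2 (Or.inr ⟨z, hz.1, hz.2.1, hz.2.2, rfl⟩))
        y hy z hz.1 hz.2.1.symm rfl
    -- There are finitely many options, so at fine scales their labels have all settled, and the
    -- lattice options are exactly the cells of the true ones.
    filter_upwards [ih1, ih2, eventually_cell_closer_iff hL hx hy,
      eventually_cell_closer_iff hL hy hx] with m h1 h2 c1 c2
    rw [latticeLabel, ← (hG s(x, y) ⟨x, hx, y, hy, hxy, rfl⟩).csInf_eq]
    congr 1
    ext n
    simp only [Set.mem_ofPred_eq]
    constructor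
    · rintro ⟨l1, l2⟩ t ht
      rcases (frogMove_mk_iff hx hy hxy t).1 ht with ⟨z, hz, hzx, hlt, rfl⟩ | ⟨z, hz, hzx, hlt, rfl⟩
      · rw [← h1 z ⟨hz, hzx, hlt⟩]
        have := (c1 z hz).2 ⟨hzx, hlt⟩
        exact l1 _ ⟨z, hz, rfl⟩ this.1 this.2
      · rw [← h2 z ⟨hz, hzx, hlt⟩]
        have := (c2 z hz).2 ⟨hzx, hlt⟩
        exact l2 _ ⟨z, hz, rfl⟩ this.1 this.2
    · intro h
      constructor
      · rintro _ ⟨z, hz, rfl⟩ hne hlt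
        obtain ⟨hzx, hlt⟩ := (c1 z hz).1 ⟨hne, hlt⟩
        rw [h1 z ⟨hz, hzx, hlt⟩]
        exact h _ ((frogMove_mk_iff hx hy hxy _).2 (Or.inl ⟨z, hz, hzx, hlt, rfl⟩))
      · rintro _ ⟨z, hz, rfl⟩ hne hlt
        obtain ⟨hzx, hlt⟩ := (c2 z hz).1 ⟨hne, hlt⟩
        rw [h2 z ⟨hz, hzx, hlt⟩]
        exact h _ ((frogMove_mk_iff hx hy hxy _).2 (Or.inr ⟨z, hz, hzx, hlt, rfl⟩))

/-- Some point of `L` in the unit cube `q` has no partner with label `n` near `q`. -/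
def LocallyUnmatched (L : Set (EuclideanSpace ℝ (Fin d)))
    (G : Sym2 (EuclideanSpace ℝ (Fin d)) → ℕ) (n R : ℕ) (q : Fin d → ℤ) : Prop :=
  ∃ x ∈ L, cell 0 x = q ∧ ∀ y ∈ L, y ≠ x → (∀ i, |cell 0 y i - q i| ≤ R) → G s(x, y) ≠ n

lemma finite_inter_cube (hL : IsTame L) (m : ℕ) (u : Fin d → ℤ) : (L ∩ cube m u).Finite :=
  (hL.finite_inter (corner m u) (mesh d m)).subset fun _ hx =>
    ⟨hx.1, dist_le_mesh (hx.2.trans (cell_corner m u).symm)⟩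

/-- The cutoff `R` leaves finitely many points of `L`, so all labels involved are correct
simultaneously from some scale on. -/
lemma eventually_latticeUnmatched_iff (hL : IsTame L) {G : Sym2 (EuclideanSpace ℝ (Fin d)) → ℕ}
    (hG : IsGrundyLabelling L G) (n R : ℕ) (q : Fin d → ℤ) :
    ∀ᶠ m in Filter.atTop, LatticeUnmatched m n R q (occ m L) ↔ LocallyUnmatched L G n R q := by
  have hF : {x | x ∈ L ∧ ∀ i, |cell 0 x i - q i| ≤ R}.Finite := by
    refine ((Set.finite_Icc (fun i => q i - R) (fun i => q i + R)).biUnion fun u _ =>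
      finite_inter_cube hL 0 u).subset fun x hx => ?_
    refine Set.mem_biUnion (x := cell 0 x) ⟨fun i => ?_, fun i => ?_⟩ ⟨hx.1, rfl⟩
    · have := (abs_le.1 (hx.2 i)).1
      simp only
      linarith
    · have := (abs_le.1 (hx.2 i)).2
      simp only
      linarith
  have hpair := (Filter.eventually_all_finite hF).2 fun x hx =>
    (Filter.eventually_all_finite hF).2 fun y hy => show ∀ᶠ m in Filter.atTop, x ≠ y →
      cell m x ≠ cell m y ∧ latticeLabel (occ m L) (cell m x) (cell m y) = G s(x, y) by
        by_cases hxy : x = y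
        · simp [hxy]
        · filter_upwards [eventually_cell_ne hxy, eventually_latticeLabel_eq hL hG hx.1 hy.1 hxy]
            with m h1 h2 _ using ⟨h1, h2⟩
  have hq : ∀ x, cell 0 x = q → ∀ i, |cell 0 x i - q i| ≤ R := by
    rintro x rfl i
    simp
  filter_upwards [hpair] with m hm
  constructor
  · rintro ⟨_, ⟨⟨x, hx, rfl⟩, hxq⟩, h⟩
    rw [unitCell_cell] at hxq
    refine ⟨x, hx, hxq, fun y hy hyx hyR => ?_⟩
    obtain ⟨h1, h2⟩ := hm x ⟨hx, hq x hxq⟩ y ⟨hy, hyR⟩ hyx.symm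
    rw [← h2]
    exact h _ ⟨y, hy, rfl⟩ h1.symm (by rwa [unitCell_cell])
  · rintro ⟨x, hx, hxq, h⟩
    refine ⟨cell m x, ⟨⟨x, hx, rfl⟩, by rwa [unitCell_cell]⟩, ?_⟩
    rintro _ ⟨y, hy, rfl⟩ hne hyR
    rw [unitCell_cell] at hyR
    have hyx : y ≠ x := fun h => hne (by rw [h])
    rw [(hm x ⟨hx, hq x hxq⟩ y ⟨hy, hyR⟩ hyx.symm).2]
    exact h y hy hyx hyR

/-- A unit cube holds finitely many points of `L`; if each had a partner, one `R` would reach all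
the partners. -/
lemma forall_locallyUnmatched_iff (hL : IsTame L) {G : Sym2 (EuclideanSpace ℝ (Fin d)) → ℕ}
    (n : ℕ) (q : Fin d → ℤ) :
    (∀ R, LocallyUnmatched L G n R q) ↔ ∃ x ∈ unmatched L G n, cell 0 x = q := by
  constructor
  · intro h
    by_contra! hno
    have hev : ∀ᶠ R : ℕ in Filter.atTop, ∀ x ∈ L ∩ cube 0 q, ¬ ∀ y ∈ L, y ≠ x →
        (∀ i, |cell 0 y i - q i| ≤ R) → G s(x, y) ≠ n := by
      rw [Filter.eventually_all_finite (finite_inter_cube hL 0 q)]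
      rintro x ⟨hx, hxq⟩
      have hx' : x ∉ unmatched L G n := fun h => hno x h hxq
      have hx'' : ∃ y ∈ L, y ≠ x ∧ G s(x, y) = n := by
        by_contra! h
        exact hx' ⟨hx, h⟩
      obtain ⟨y, hy, hyx, hyn⟩ := hx''
      obtain ⟨R, hR⟩ := (Finset.univ.image fun i => (cell 0 y i - q i).natAbs).exists_nat_subset_range
      refine Filter.eventually_atTop.2 ⟨R, fun R' hR' h => h y hy hyx (fun i => ?_) hyn⟩
      have := Finset.mem_range.1 (hR (Finset.mem_image_of_mem _ (Finset.mem_univ i)))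
      rw [Int.abs_eq_natAbs]
      exact_mod_cast (this.le.trans hR')
    obtain ⟨R, hR⟩ := hev.exists
    obtain ⟨x, hx, hxq, hxR⟩ := h R
    exact hR x ⟨hx, hxq⟩ hxR
  · rintro ⟨x, ⟨hx, h⟩, hxq⟩ R
    exact ⟨x, hx, hxq, fun y hy hyx _ => h y hy hyx⟩

end Discretization

/-! ### Every point of a Poisson process has a partner with each label -/

section Matching

variable {Ω : Type*} [MeasurableSpace Ω] {P : Measure Ω} {d : ℕ} {lam : ℝ≥0}
  {L : Ω → Set (EuclideanSpace ℝ (Fin d))}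

lemma IsPoissonProcess.identDistrib_mem_occ (hL : IsPoissonProcess P lam L) (m : ℕ)
    (u v : Fin d → ℤ) :
    IdentDistrib (fun ω => u ∈ occ m (L ω)) (fun ω => v ∈ occ m (L ω)) P P := by
  have hm := fun u : Fin d → ℤ => hL.measurable_count _ (measurableSet_cube m u)
  have hlaw := fun u : Fin d → ℤ => hL.law_count _ (measurableSet_cube m u)
    (by rw [volume_cube]; exact ENNReal.coe_lt_top)
  have h : IdentDistrib (count L (cube m u)) (count L (cube m v)) P P :=
    ⟨(hm u).aemeasurable, (hm v).aemeasurable, by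
      rw [hlaw, hlaw, volume_cube, volume_cube]⟩
  have h' := h.comp (u := fun n : ℕ∞ => n ≠ 0)
    (measurableSet_setOfPred.1 (measurableSet_singleton (0 : ℕ∞)).compl)
  simpa only [Function.comp_def, count_ne_zero_iff] using h'

lemma IsPoissonProcess.measurableSet_latticeUnmatched (hL : IsPoissonProcess P lam L)
    (m n R : ℕ) (q : Fin d → ℤ) : MeasurableSet {ω | LatticeUnmatched m n R q (occ m (L ω))} :=
  measurableSet_setOfPred.2 ((measurable_latticeUnmatched m n R q).comp (hL.measurable_occ m))

/-- Occupancies of equal cubes are i.i.d., so the occupied set and its lattice shifts have the same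
law. -/
lemma IsPoissonProcess.measure_latticeUnmatched (hL : IsPoissonProcess P lam L) (m n R : ℕ)
    (q : Fin d → ℤ) : P {ω | LatticeUnmatched m n R q (occ m (L ω))} =
      P {ω | LatticeUnmatched m n R 0 (occ m (L ω))} := by
  let w : Fin d → ℤ := fun i => q i * ((2 ^ m : ℕ) : ℤ)
  have h := IdentDistrib.pi (fun u => hL.identDistrib_mem_occ m u (u + w)) (hL.iIndepFun_occ m)
    ((hL.iIndepFun_occ m).precomp (add_left_injective w))
  have hset : Measurable fun f : (Fin d → ℤ) → Prop => {u | f u} :=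
    measurable_set_iff.2 fun u => measurable_pi_apply u
  have h' := (h.comp hset).measure_mem_eq
    (measurableSet_setOfPred.2 (measurable_latticeUnmatched m n R 0))
  refine Eq.trans ?_ h'.symm
  congr 1
  ext ω
  exact (latticeUnmatched_preimage_add m n R q (occ m (L ω))).symm

theorem IsPoissonProcess.ae_unmatched_eq_empty [IsProbabilityMeasure P] (hlam : 0 < lam)
    (hL : IsPoissonProcess P lam L)
    {G : Ω → Sym2 (EuclideanSpace ℝ (Fin d)) → ℕ}
    (hG : ∀ᵐ ω ∂P, IsTame (L ω) ∧ IsGrundyLabelling (L ω) (G ω)) (n : ℕ) :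
    ∀ᵐ ω ∂P, unmatched (L ω) (G ω) n = ∅ := by
  have hd := hL.dim_pos hlam
  let E : ℕ → ℕ → (Fin d → ℤ) → Set Ω := fun R m q =>
    {ω | LatticeUnmatched m n R q (occ m (L ω))}
  have hE : ∀ R m q, MeasurableSet (E R m q) := fun R m q =>
    hL.measurableSet_latticeUnmatched m n R q
  -- A measurable event that almost surely coincides with `LocallyUnmatched`; `G` itself need not be
  -- measurable in `ω`.
  let A : ℕ → (Fin d → ℤ) → Set Ω := fun R q => {ω | ∀ᶠ m in Filter.atTop, ω ∈ E R m q}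
  have hA : ∀ R q, MeasurableSet (A R q) := fun R q => by
    refine measurableSet_setOfPred.2 ?_
    simp only [Filter.eventually_atTop]
    exact Measurable.exists fun m => Measurable.forall fun b => measurable_const.imp
      (measurableSet_setOfPred.1 (hE R b q))
  have hev : ∀ᵐ ω ∂P, ∀ R q, ∀ᶠ m in Filter.atTop,
      ω ∈ E R m q ↔ LocallyUnmatched (L ω) (G ω) n R q := by
    filter_upwards [hG] with ω hω R q
    exact eventually_latticeUnmatched_iff hω.1 hω.2 n R q
  have hAiff : ∀ᵐ ω ∂P, ∀ R q, ω ∈ A R q ↔ LocallyUnmatched (L ω) (G ω) n R q := by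
    filter_upwards [hev] with ω hω R q
    exact (Filter.eventually_congr (hω R q)).trans Filter.eventually_const
  have hlim : ∀ R q, Filter.Tendsto (fun m => P (E R m q)) Filter.atTop (nhds (P (A R q))) := by
    intro R q
    refine tendsto_measure_of_ae_tendsto_indicator_of_isFiniteMeasure _ (hA R q)
      (fun m => hE R m q) ?_
    filter_upwards [hev, hAiff] with ω h1 h2
    filter_upwards [h1 R q] with m hm
    rw [hm, h2]
  have hAq : ∀ R q, P (A R q) = P (A R 0) := fun R q =>
    tendsto_nhds_unique (hlim R q) ((hlim R 0).congr fun m =>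
      (hL.measure_latticeUnmatched m n R q).symm)
  have hAanti : ∀ q, Antitone fun R => A R q := by
    intro q R R' hR ω hω
    refine Filter.Eventually.mono hω fun m hm => ?_
    obtain ⟨u, hu, h⟩ := hm
    exact ⟨u, hu, fun v hv hvu hvR => h v hv hvu fun i => (hvR i).trans (by exact_mod_cast hR)⟩
  -- Almost surely, `U q` says that the unit cube `q` contains an unmatched point.
  let U : (Fin d → ℤ) → Set Ω := fun q => ⋂ R, A R q
  have hU : ∀ q, MeasurableSet (U q) := fun q => MeasurableSet.iInter fun R => hA R q
  have hUlim : ∀ q, Filter.Tendsto (fun R => P (A R q)) Filter.atTop (nhds (P (U q))) := fun q =>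
    tendsto_measure_iInter_atTop (fun R => (hA R q).nullMeasurableSet) (hAanti q)
      ⟨0, measure_ne_top _ _⟩
  have hUq : ∀ q, P (U q) = P (U 0) := fun q =>
    tendsto_nhds_unique (hUlim q) ((hUlim 0).congr fun R => (hAq R q).symm)
  have hUiff : ∀ᵐ ω ∂P, ∀ q, ω ∈ U q ↔ ∃ x ∈ unmatched (L ω) (G ω) n, cell 0 x = q := by
    filter_upwards [hAiff, hG] with ω h1 h2 q
    rw [← forall_locallyUnmatched_iff h2.1, Set.mem_iInter]
    exact forall_congr' fun R => h1 R q
  -- The sum of probabilities is the expected number of cubes in `S` with an unmatched point; one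
  -- such point from each gives distinct points, at most `n + 1` in all.
  have hsum : ∀ S : Finset (Fin d → ℤ), S.card * P (U 0) ≤ n + 1 := by
    intro S
    classical
    calc S.card * P (U 0) = ∑ q ∈ S, P (U q) := by simp [hUq]
      _ = ∑ q ∈ S, ∫⁻ ω, (U q).indicator 1 ω ∂P := by
          simp only [lintegral_indicator_one (hU _)]
      _ = ∫⁻ ω, ∑ q ∈ S, (U q).indicator 1 ω ∂P :=
          (lintegral_finsetSum _ fun q _ => measurable_one.indicator (hU q)).symm
      _ ≤ ∫⁻ _, (n + 1 : ℝ≥0∞) ∂P := by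
          refine lintegral_mono_ae ?_
          filter_upwards [hUiff, hG] with ω h1 h2
          have h3 : ∀ q, ∃ x, ω ∈ U q → x ∈ unmatched (L ω) (G ω) n ∧ cell 0 x = q := by
            intro q
            by_cases hq : ω ∈ U q
            · obtain ⟨x, hx, hxq⟩ := (h1 q).1 hq
              exact ⟨x, fun _ => ⟨hx, hxq⟩⟩
            · exact ⟨0, fun h => absurd h hq⟩
          choose x hx using h3
          have hcard := card_le_of_subset_unmatched h2.1 h2.2 n
            ((S.filter fun q => ω ∈ U q).image x) (by
              intro y hy
              obtain ⟨q, hq, rfl⟩ := Finset.mem_image.1 hy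
              exact (hx q (Finset.mem_filter.1 hq).2).1)
          rw [Finset.card_image_of_injOn] at hcard
          · simp only [Set.indicator_apply, Pi.one_apply, Finset.sum_boole]
            exact_mod_cast hcard
          · intro q hq q' hq' h
            rw [← (hx q (Finset.mem_filter.1 hq).2).2, ← (hx q' (Finset.mem_filter.1 hq').2).2, h]
      _ = n + 1 := by simp
  have hU0 : P (U 0) = 0 := by
    by_contra h0
    obtain ⟨N, hN⟩ := ENNReal.exists_nat_mul_gt h0 (b := n + 1) (by finiteness)
    -- Positive dimension supplies infinitely many unit cubes.
    have : Nonempty (Fin d) := ⟨⟨0, hd⟩⟩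
    obtain ⟨S, hS⟩ := Infinite.exists_subset_card_eq (Fin d → ℤ) N
    have := hsum S
    rw [hS] at this
    exact absurd hN (not_lt.2 this)
  have hUnull : ∀ᵐ ω ∂P, ∀ q, ω ∉ U q := by
    rw [ae_all_iff]
    intro q
    exact measure_eq_zero_iff_ae_notMem.1 ((hUq q).trans hU0)
  filter_upwards [hUiff, hUnull] with ω h1 h2
  exact Set.eq_empty_iff_forall_notMem.2 fun x hx => h2 _ ((h1 (cell 0 x)).2 ⟨x, hx, rfl⟩)

/-- Almost surely, friendly frogs on a Poisson process has a labelling by the mex rule for which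
every point has a unique partner with each label. -/
theorem IsPoissonProcess.ae_exists_labelling [IsProbabilityMeasure P] (hlam : 0 < lam)
    (hL : IsPoissonProcess P lam L) :
    ∀ᵐ ω ∂P, IsTame (L ω) ∧ ∃ G, IsGrundyLabelling (L ω) G ∧
      ∀ x ∈ L ω, ∀ n : ℕ, ∃! y, y ∈ L ω ∧ y ≠ x ∧ G s(x, y) = n := by
  have hex : ∀ ω, ∃ G, IsTame (L ω) → IsGrundyLabelling (L ω) G := by
    intro ω
    by_cases h : IsTame (L ω)
    · obtain ⟨G, hG⟩ := h.exists_isGrundyLabelling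
      exact ⟨G, fun _ => hG⟩
    · exact ⟨0, fun h' => absurd h' h⟩
  choose G hG using hex
  have hG' : ∀ᵐ ω ∂P, IsTame (L ω) ∧ IsGrundyLabelling (L ω) (G ω) := by
    filter_upwards [hL.ae_isTame hlam] with ω hω using ⟨hω, hG ω hω⟩
  have hun : ∀ᵐ ω ∂P, ∀ n, unmatched (L ω) (G ω) n = ∅ :=
    ae_all_iff.2 fun n => hL.ae_unmatched_eq_empty hlam hG' n
  filter_upwards [hG', hun] with ω hω hn
  refine ⟨hω.1, G ω, hω.2, fun x hx n => ?_⟩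
  have hx' : x ∉ unmatched (L ω) (G ω) n := by simp [hn n]
  have hy : ∃ y ∈ L ω, y ≠ x ∧ G ω s(x, y) = n := by
    by_contra! h
    exact hx' ⟨hx, h⟩
  obtain ⟨y, hy, hyx, hyn⟩ := hy
  exact ⟨y, ⟨hy, hyx, hyn⟩, fun z ⟨hz, hzx, hzn⟩ =>
    hω.2.eq_of_label_eq hω.1 hx hz hy hzx hyx (hzn.trans hyn.symm)⟩

end Matching

end FriendlyFrogs

theorem mainTheorem5 {Ω : Type*} [MeasurableSpace Ω] (P : Measure Ω) [IsProbabilityMeasure P]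
    (d k : ℕ) (hk : 1 ≤ k)
    (lam : Fin k → ℝ≥0) (hlam : ∀ i, 0 < lam i)
    (L : Fin k → Ω → Set (EuclideanSpace ℝ (Fin d)))
    (hL : ∀ i, FriendlyFrogs.IsPoissonProcess P (lam i) (L i))
    (hindep : iIndep (fun i => FriendlyFrogs.sigmaOf (L i)) P) :
    ∀ᵐ ω ∂P,
      -- Bob wins, when the last frog is placed in the last of the `k` ponds
      FriendlyFrogs.BobWins (fun i => L i ω) (⟨k - 1, by omega⟩ : Fin k) ∧
      -- the labels exist, and each label occurs exactly once at each point
      (∃ G : Fin k → Sym2 (EuclideanSpace ℝ (Fin d)) → ℕ,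
        ∀ i, FriendlyFrogs.IsGrundyLabelling (L i ω) (G i) ∧
          ∀ x ∈ L i ω, ∀ n : ℕ, ∃! y, y ∈ L i ω ∧ y ≠ x ∧ G i s(x, y) = n) ∧
      -- the P-positions are those where the XOR of the labels vanishes
      ∀ G : Fin k → Sym2 (EuclideanSpace ℝ (Fin d)) → ℕ,
        (∀ i, FriendlyFrogs.IsGrundyLabelling (L i ω) (G i)) →
        ∀ s : Fin k → Sym2 (EuclideanSpace ℝ (Fin d)),
          (∀ i, FriendlyFrogs.IsFrogPair (L i ω) (s i)) →
          (FriendlyFrogs.IsPPosition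
              (FriendlyFrogs.PondMove (fun i => L i ω) (⟨k - 1, by omega⟩ : Fin k))
              (FriendlyFrogs.Position.full s) ↔
            FriendlyFrogs.nimSum (fun i => G i (s i)) = 0) := by
  have hall : ∀ᵐ ω ∂P, ∀ i, FriendlyFrogs.IsTame (L i ω) ∧
      ∃ G, FriendlyFrogs.IsGrundyLabelling (L i ω) G ∧
        ∀ x ∈ L i ω, ∀ n : ℕ, ∃! y, y ∈ L i ω ∧ y ≠ x ∧ G s(x, y) = n :=
    ae_all_iff.2 fun i => (hL i).ae_exists_labelling (hlam i)
  filter_upwards [hall] with ω hω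
  choose htame G hG huniq using hω
  exact ⟨FriendlyFrogs.bobWins_of_forall_exists htame hG fun x hx n => (huniq _ x hx n).exists,
    ⟨G, fun i => ⟨hG i, huniq i⟩⟩,
    fun G' hG' s hs => FriendlyFrogs.isPPosition_full_iff htame hG' s hs⟩
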